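/- Let $n,N$ be natural numbers and write $L^q=L^q(\mathbb R^n;\mathbb C^N)$. Let $D=-i\sum_{j=1}^n A_j\partial_j$, with $A_j\in\mathcal L(\mathbb C^N)$, be a first order differential operator with constant coefficients whose symbol $\widehat D(\xi)=\sum_j \xi_jA_j$ satisfies: there is $\kappa>0$ such that $\kappa|\xi||e|\le|\widehat D(\xi)e|$ for all $\xi\in\mathbb R^n$ and all $e$ in the range of $\widehat D(\xi)$; and there is $\omega\in[0,\pi/2)$ such that $\sigma(\widehat D(\xi))\subseteq \overline S_\omega$ for all $\xi\in\mathbb R^n$. Here $S_\omega=\{z\in\mathbb C\setminus\{0\}: |\arg(\pm z)|<\omega\}$ and $\overline S_\omega=\{0\}\cup\{z\neq0:|\arg(\pm z)|\le\omega\}$, where $|\arg(\pm z)|<\omega$ means that $|\arg z|<\omega$ or $|\arg(-z)|<\omega$, and similarly for $\le$. For $1<q<\infty$ consider $D$ on $L^q$ with domain $\{u\in L^q: Du\in L^q\}$ ($Du$ in the sense of distributions), and let $\mathsf R_q(D)$ be its range. Let $D^*=-i\sum_j A_j^*\partial_j$, considered on $L^q$ in the same way. Let $B\in L^\infty(\mathbb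 R^n;\mathcal L(\mathbb C^N))$ act on $L^q$ by multiplication, and let $B^*(x)=B(x)^*$. The operator $BD$ on $L^q$ has the domain of $D$ on $L^q$. A closed operator $\mathcal A$ on a complex Banach space is bisectorial if there is $\omega\in[0,\pi/2)$ such that $\sigma(\mathcal A)\subseteq\overline S_\omega$ and, for every $\omega'>\omega$, $\sup\{\|(I+\lambda\mathcal A)^{-1}\|:\lambda\ne0,\ \lambda\notin S_{\omega'}\}<\infty$. A closed operator $\mathcal A$ on $L^q$ is $R$-bisectorial if there is $\omega\in[0,\pi/2)$ such that $\sigma(\mathcal A)\subseteq\overline S_\omega$ and, for every $\omega'>\omega$, there is $C>0$ with $$\Big\|\Big(\sum_{j=1}^k|(I+\lambda_j\mathcal A)^{-1}u_j|^2\Big)^{1/2}\Big\|_q\le C\Big\|\Big(\sum_{j=1}^k|u_j|^2\Big)^{1/2}\Big\|_q$$ for all $k\in\mathbb N$, all nonzero $\lambda_1,\dots,\lambda_k\notin S_{\omega'}$ and all $u_1,\dots,u_k\in L^q$. Define $$\mathcal I(BD)=\{q\in(1,\infty):\ \exists c>0,\ \|Bu\|_q\ge c\|u\|_q\ \text{for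 all } u\in\mathsf R_q(D)\},$$ $$\mathcal B(BD)=\{q\in\mathcal I(BD): BD \text{ is bisectorial in } L^q\},\qquad \mathcal R(BD)=\{q\in\mathcal I(BD): BD \text{ is } R\text{-bisectorial in } L^q\},$$ and define $\mathcal I(B^*D^*)$, $\mathcal B(B^*D^*)$, $\mathcal R(B^*D^*)$ in the same way with $B^*,D^*$ in place of $B,D$. Let $1<p<\infty$ and $p'=p/(p-1)$. Then $p\in\mathcal R(BD)$ if and only if $p'\in\mathcal R(B^*D^*)$, and $p\in\mathcal B(BD)$ if and only if $p'\in\mathcal B(B^*D^*)$. -/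

import Mathlib

open MeasureTheory
open scoped ENNReal

noncomputable section

namespace DiracLp

/-! ### Bisectors and (R-)bisectorial unbounded operators -/

/-- The open bisector `S_ω = {z ≠ 0 : |arg (± z)| < ω}`. -/
def openBisector (ω : ℝ) : Set ℂ :=
  {z | z ≠ 0 ∧ (|Complex.arg z| < ω ∨ |Complex.arg (-z)| < ω)}

/-- The closed bisector `{0} ∪ {z : |arg (± z)| ≤ ω}`: the closure of the open bisector if
`0 < ω < π / 2`, and the real line if `ω = 0`. -/
def closedBisector (ω : ℝ) : Set ℂ :=
  {z | z = 0 ∨ |Complex.arg z| ≤ ω ∨ |Complex.arg (-z)| ≤ ω}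

section Abstract

variable {X : Type*} [NormedAddCommGroup X] [NormedSpace ℂ X]

/-- `R` is a bounded, everywhere defined, two-sided inverse of the unbounded operator
`a I + b 𝒜`, whose domain is that of `𝒜` (used only if `(a, b)` is `(z, -1)` or `(1, λ)` with
`λ ≠ 0`). -/
def IsBoundedInverse (A : X →ₗ.[ℂ] X) (a b : ℂ) (R : X →L[ℂ] X) : Prop :=
  (∀ x : X, ∃ h : R x ∈ A.domain, a • R x + b • A ⟨R x, h⟩ = x) ∧
    ∀ x : A.domain, R (a • (x : X) + b • A x) = x

/-- The spectrum of an unbounded operator: the set of `z` such that `z I - 𝒜` has no bounded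
everywhere defined inverse. -/
def unboundedSpectrum (A : X →ₗ.[ℂ] X) : Set ℂ :=
  {z | ¬ ∃ R : X →L[ℂ] X, IsBoundedInverse A z (-1) R}

/-- `𝒜` is bisectorial of angle `ω`: it is closed, its spectrum is in the closed bisector of
angle `ω`, and for all `ω' > ω` the operators `(I + λ 𝒜)⁻¹` with `λ ∉ S_ω'`, `λ ≠ 0` are
uniformly bounded. -/
def IsBisectorialOfAngle (A : X →ₗ.[ℂ] X) (ω : ℝ) : Prop :=
  A.IsClosed ∧ unboundedSpectrum A ⊆ closedBisector ω ∧
    ∀ ω' : ℝ, ω < ω' → ∃ C : ℝ, ∀ l : ℂ, l ≠ 0 → l ∉ openBisector ω' →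
      ∃ R : X →L[ℂ] X, IsBoundedInverse A 1 l R ∧ ‖R‖ ≤ C

/-- `𝒜` is bisectorial, of some angle in `[0, π / 2)`. -/
def IsBisectorial (A : X →ₗ.[ℂ] X) : Prop :=
  ∃ ω : ℝ, 0 ≤ ω ∧ ω < Real.pi / 2 ∧ IsBisectorialOfAngle A ω

end Abstract

section RBisectorial

variable {Ω V : Type*} [MeasurableSpace Ω] {μ : Measure Ω}
  [NormedAddCommGroup V] [NormedSpace ℂ V] {q : ℝ≥0∞} [Fact (1 ≤ q)]

/-- The norm `‖(∑ j, |u j|²)^{1/2}‖_q` of a finite family in `L^q`. -/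
def squareFunctionNorm {k : ℕ} (u : Fin k → Lp V q μ) : ℝ≥0∞ :=
  eLpNorm (fun x => Real.sqrt (∑ j, ‖u j x‖ ^ 2)) q μ

/-- `𝒜` is R-bisectorial of angle `ω` in `L^q`: it is closed, its spectrum is in the closed
bisector of angle `ω`, and for all `ω' > ω` the family of the operators `(I + λ 𝒜)⁻¹` with
`λ ∉ S_ω'`, `λ ≠ 0`, satisfies the square function criterion of R-boundedness. -/
def IsRBisectorialOfAngle (A : Lp V q μ →ₗ.[ℂ] Lp V q μ) (ω : ℝ) : Prop :=
  A.IsClosed ∧ unboundedSpectrum A ⊆ closedBisector ω ∧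
    ∀ ω' : ℝ, ω < ω' → ∃ C : ℝ, 0 < C ∧ ∀ (k : ℕ) (l : Fin k → ℂ),
      (∀ j, l j ≠ 0 ∧ l j ∉ openBisector ω') →
      ∃ R : Fin k → (Lp V q μ →L[ℂ] Lp V q μ), (∀ j, IsBoundedInverse A 1 (l j) (R j)) ∧
        ∀ u : Fin k → Lp V q μ, squareFunctionNorm (fun j => R j (u j)) ≤
          ENNReal.ofReal C * squareFunctionNorm u

/-- `𝒜` is R-bisectorial in `L^q`, of some angle in `[0, π / 2)`. -/
def IsRBisectorial (A : Lp V q μ →ₗ.[ℂ] Lp V q μ) : Prop :=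
  ∃ ω : ℝ, 0 ≤ ω ∧ ω < Real.pi / 2 ∧ IsRBisectorialOfAngle A ω

end RBisectorial

/-! ### First order operators with constant coefficients -/

/-- `ℝⁿ`. -/
abbrev Rn (n : ℕ) : Type := EuclideanSpace ℝ (Fin n)

/-- `ℂᴺ` with its Hermitian norm. -/
abbrev CN (N : ℕ) : Type := EuclideanSpace ℂ (Fin N)

/-- `L^q(ℝⁿ; ℂᴺ)`. -/
abbrev LqSpace (n N : ℕ) (q : ℝ≥0∞) : Type := Lp (CN N) q (volume : Measure (Rn n))

/-- A homogeneous first order differential operator `D = -i ∑ j, A_j ∂_j` on `ℝⁿ` with constant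
coefficients `A_j ∈ 𝓛(ℂᴺ)`, acting on functions with values in `ℂᴺ`. -/
structure FirstOrderOp (n N : ℕ) where
  /-- The coefficients `A_j`. -/
  coeff : Fin n → (CN N →L[ℂ] CN N)

/-- The formal adjoint `D^* = -i ∑ j, A_j^* ∂_j`. -/
def FirstOrderOp.adjoint {n N : ℕ} (D : FirstOrderOp n N) : FirstOrderOp n N :=
  ⟨fun j => ContinuousLinearMap.adjoint (D.coeff j)⟩

/-- The symbol `D̂(ξ) = ∑ j, ξ_j A_j`. -/
def FirstOrderOp.symbol {n N : ℕ} (D : FirstOrderOp n N) (ξ : Rn n) : CN N →L[ℂ] CN N :=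
  ∑ j, (ξ j : ℂ) • D.coeff j

/-- There is `κ > 0` with `κ |ξ| |e| ≤ |D̂(ξ) e|` for all `ξ` and all `e` in the range
of `D̂(ξ)`. -/
def FirstOrderOp.SymbolCoercive {n N : ℕ} (D : FirstOrderOp n N) : Prop :=
  ∃ κ : ℝ, 0 < κ ∧ ∀ (ξ : Rn n), ∀ e ∈ LinearMap.range (D.symbol ξ).toLinearMap,
    κ * ‖ξ‖ * ‖e‖ ≤ ‖D.symbol ξ e‖

/-- There is `ω ∈ [0, π / 2)` such that the spectrum of `D̂(ξ)` is in the closed bisector of angle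
`ω` for all `ξ`. -/
def FirstOrderOp.SymbolBisectorial {n N : ℕ} (D : FirstOrderOp n N) : Prop :=
  ∃ ω : ℝ, 0 ≤ ω ∧ ω < Real.pi / 2 ∧ ∀ ξ : Rn n, spectrum ℂ (D.symbol ξ) ⊆ closedBisector ω

/-- `D u = f` in the sense of distributions: for all (real) test functions `φ`,
`∫ φ f = i ∑ j, ∫ (∂_j φ) A_j u`. -/
def FirstOrderOp.WeakEq {n N : ℕ} (D : FirstOrderOp n N) (u f : Rn n → CN N) : Prop :=
  ∀ φ : Rn n → ℝ, ContDiff ℝ ((⊤ : ℕ∞) : WithTop ℕ∞) φ → HasCompactSupport φ →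
    ∫ x, φ x • f x =
      Complex.I • ∑ j, ∫ x, (fderiv ℝ φ x (EuclideanSpace.single j 1)) • D.coeff j (u x)

section Realization

variable {n N : ℕ} (D : FirstOrderOp n N) (q : ℝ≥0∞) [hq : Fact (1 ≤ q)]

theorem integrable_smul_Lp {φ : Rn n → ℝ} (hφ : Continuous φ) (hc : HasCompactSupport φ)
    (f : LqSpace n N q) : Integrable (fun x => φ x • f x) :=
  ((Lp.memLp f).locallyIntegrable hq.out).integrable_smul_left_of_hasCompactSupport hφ hc

theorem integrable_smul_clm_Lp {φ : Rn n → ℝ} (hφ : Continuous φ) (hc : HasCompactSupport φ)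
    (T : CN N →L[ℂ] CN N) (f : LqSpace n N q) : Integrable (fun x => φ x • T (f x)) := by
  refine (T.integrable_comp (integrable_smul_Lp q hφ hc f)).congr (Filter.Eventually.of_forall ?_)
  intro x
  exact T.map_smul_of_tower (φ x) (f x)

theorem continuous_partial {φ : Rn n → ℝ} (hφ : ContDiff ℝ ((⊤ : ℕ∞) : WithTop ℕ∞) φ)
    (v : Rn n) : Continuous (fun x => fderiv ℝ φ x v) :=
  (hφ.continuous_fderiv (by simp)).clm_apply continuous_const

theorem hasCompactSupport_partial {φ : Rn n → ℝ} (hc : HasCompactSupport φ)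
    (v : Rn n) : HasCompactSupport (fun x => fderiv ℝ φ x v) :=
  hc.fderiv_apply ℝ v

/-- The graph of `D` in `L^q`: all `(u, f)` with `u ∈ L^q`, `f ∈ L^q` and `D u = f` in the sense
of distributions. -/
def FirstOrderOp.graphLq : Submodule ℂ (LqSpace n N q × LqSpace n N q) where
  carrier := {w | D.WeakEq w.1 w.2}
  zero_mem' := by
    intro φ hφ hc
    have h0 := Lp.coeFn_zero (CN N) q (volume : Measure (Rn n))
    have e1 : ∫ x, φ x • ((0 : LqSpace n N q) x) = 0 := by
      rw [integral_eq_zero_of_ae]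
      filter_upwards [h0] with x hx
      simp only [hx, Pi.zero_apply, map_zero, smul_zero]
    have e2 : ∀ j, ∫ x, (fderiv ℝ φ x (EuclideanSpace.single j 1)) •
        D.coeff j ((0 : LqSpace n N q) x) = 0 := by
      intro j
      rw [integral_eq_zero_of_ae]
      filter_upwards [h0] with x hx
      simp only [hx, Pi.zero_apply, map_zero, smul_zero]
    simp only [Prod.fst_zero, Prod.snd_zero, e1, e2]
    simp
  add_mem' := by
    rintro ⟨u, f⟩ ⟨v, g⟩ hu hv φ hφ hc
    have hu' := hu φ hφ hc
    have hv' := hv φ hφ hc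
    simp only at hu' hv'
    have e1 : ∫ x, φ x • ((f + g : LqSpace n N q) x) =
        (∫ x, φ x • f x) + ∫ x, φ x • g x := by
      rw [← integral_add (integrable_smul_Lp q hφ.continuous hc f)
        (integrable_smul_Lp q hφ.continuous hc g)]
      refine integral_congr_ae ?_
      filter_upwards [Lp.coeFn_add f g] with x hx
      simp only [hx, Pi.add_apply, smul_add]
    have e2 : ∀ j, ∫ x, (fderiv ℝ φ x (EuclideanSpace.single j 1)) •
        D.coeff j ((u + v : LqSpace n N q) x) =
        (∫ x, (fderiv ℝ φ x (EuclideanSpace.single j 1)) • D.coeff j (u x)) +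
          ∫ x, (fderiv ℝ φ x (EuclideanSpace.single j 1)) • D.coeff j (v x) := by
      intro j
      rw [← integral_add
        (integrable_smul_clm_Lp q (continuous_partial hφ _) (hasCompactSupport_partial hc _) _ u)
        (integrable_smul_clm_Lp q (continuous_partial hφ _) (hasCompactSupport_partial hc _) _ v)]
      refine integral_congr_ae ?_
      filter_upwards [Lp.coeFn_add u v] with x hx
      simp only [hx, Pi.add_apply, map_add, smul_add]
    simp only [Prod.fst_add, Prod.snd_add, e1, e2, hu', hv', Finset.sum_add_distrib, smul_add]
  smul_mem' := by
    rintro c ⟨u, f⟩ hu φ hφ hc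
    have hu' := hu φ hφ hc
    simp only at hu'
    have e1 : ∫ x, φ x • ((c • f : LqSpace n N q) x) = c • ∫ x, φ x • f x := by
      rw [← integral_smul]
      refine integral_congr_ae ?_
      filter_upwards [Lp.coeFn_smul c f] with x hx
      simp [hx, smul_comm c]
    have e2 : ∀ j, ∫ x, (fderiv ℝ φ x (EuclideanSpace.single j 1)) •
        D.coeff j ((c • u : LqSpace n N q) x) =
        c • ∫ x, (fderiv ℝ φ x (EuclideanSpace.single j 1)) • D.coeff j (u x) := by
      intro j
      rw [← integral_smul]
      refine integral_congr_ae ?_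
      filter_upwards [Lp.coeFn_smul c u] with x hx
      simp [hx, smul_comm c]
    simp only [Prod.smul_fst, Prod.smul_snd, e1, e2, hu', ← Finset.smul_sum]
    rw [smul_comm]

theorem FirstOrderOp.mem_graphLq {w : LqSpace n N q × LqSpace n N q} :
    w ∈ D.graphLq q ↔ D.WeakEq w.1 w.2 := Iff.rfl

theorem FirstOrderOp.graphLq_functional (w : LqSpace n N q × LqSpace n N q)
    (hw : w ∈ D.graphLq q) (h1 : w.1 = 0) : w.2 = 0 := by
  have key : ∀ᵐ x ∂(volume : Measure (Rn n)), w.2 x = 0 := by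
    refine ae_eq_zero_of_integral_contDiff_smul_eq_zero
      ((Lp.memLp w.2).locallyIntegrable hq.out) ?_
    intro φ hφ hc
    rw [hw φ hφ hc, h1]
    have h0 := Lp.coeFn_zero (CN N) q (volume : Measure (Rn n))
    have e2 : ∀ j, ∫ x, (fderiv ℝ φ x (EuclideanSpace.single j 1)) •
        D.coeff j ((0 : LqSpace n N q) x) = 0 := by
      intro j
      rw [integral_eq_zero_of_ae]
      filter_upwards [h0] with x hx
      simp only [hx, Pi.zero_apply, map_zero, smul_zero]
    simp only [e2]
    simp
  exact (Lp.eq_zero_iff_ae_eq_zero).2 key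

/-- The realization `D_q` of `D` in `L^q(ℝⁿ; ℂᴺ)`, with domain `{u ∈ L^q : D u ∈ L^q}`. -/
def FirstOrderOp.opLq : LqSpace n N q →ₗ.[ℂ] LqSpace n N q :=
  (D.graphLq q).toLinearPMap

theorem FirstOrderOp.graph_opLq : (D.opLq q).graph = D.graphLq q :=
  Submodule.toLinearPMap_graph_eq _ (D.graphLq_functional q)

/-! ### Bounded multiplication operators and the perturbed operator `B D` -/

/-- `L^∞(ℝⁿ; 𝓛(ℂᴺ))`. Its `star` is the pointwise adjoint `B^*(x) = B(x)^*`. -/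
abbrev LinftyMat (n N : ℕ) : Type := Lp (CN N →L[ℂ] CN N) ∞ (volume : Measure (Rn n))

/-- The operator of multiplication by `B` on `L^q`, `(B u)(x) = B(x) u(x)`. -/
def mulLq (B : LinftyMat n N) : LqSpace n N q →L[ℂ] LqSpace n N q :=
  (ContinuousLinearMap.id ℂ (CN N →L[ℂ] CN N)).holderL volume ∞ q q B

theorem coeFn_mulLq (B : LinftyMat n N) (u : LqSpace n N q) :
    mulLq q B u =ᵐ[volume] fun x => B x (u x) :=
  (ContinuousLinearMap.id ℂ (CN N →L[ℂ] CN N)).coeFn_holder (r := q) B u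

theorem coeFn_star_LinftyMat (B : LinftyMat n N) :
    (star B : LinftyMat n N) =ᵐ[volume] fun x => ContinuousLinearMap.adjoint (B x) :=
  Lp.coeFn_star B

/-- The operator `B D` in `L^q`, with domain that of `D_q`. -/
def opBD (B : LinftyMat n N) : LqSpace n N q →ₗ.[ℂ] LqSpace n N q :=
  (mulLq q B).toLinearMap.compPMap (D.opLq q)

/-- `‖B u‖_q ≳ ‖u‖_q` for all `u` in the range of `D_q`. -/
def LowerBoundOnRange (B : LinftyMat n N) : Prop :=
  ∃ c : ℝ, 0 < c ∧ ∀ u ∈ LinearMap.range (D.opLq q).toFun, c * ‖u‖ ≤ ‖mulLq q B u‖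

end Realization

theorem fact_one_le_ofReal {q : ℝ} (h : 1 < q) : Fact (1 ≤ ENNReal.ofReal q) :=
  ⟨ENNReal.one_le_ofReal.2 h.le⟩

variable {n N : ℕ}

/-- The set `𝓘(BD)` of the exponents `q ∈ (1, ∞)` for which `B` is bounded below on the range
of `D` in `L^q`. -/
def setI (B : LinftyMat n N) (D : FirstOrderOp n N) : Set ℝ :=
  {q | ∃ h : 1 < q, haveI := fact_one_le_ofReal h
    LowerBoundOnRange D (ENNReal.ofReal q) B}

/-- The set `𝓑(BD)` of the exponents `q ∈ 𝓘(BD)` for which `BD` is bisectorial in `L^q`. -/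
def setB (B : LinftyMat n N) (D : FirstOrderOp n N) : Set ℝ :=
  {q | q ∈ setI B D ∧ ∃ h : 1 < q, haveI := fact_one_le_ofReal h
    IsBisectorial (opBD D (ENNReal.ofReal q) B)}

/-- The set `𝓡(BD)` of the exponents `q ∈ 𝓘(BD)` for which `BD` is R-bisectorial in `L^q`. -/
def setR (B : LinftyMat n N) (D : FirstOrderOp n N) : Set ℝ :=
  {q | q ∈ setI B D ∧ ∃ h : 1 < q, haveI := fact_one_le_ofReal h
    IsRBisectorial (opBD D (ENNReal.ofReal q) B)}

end DiracLp

end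

/-!
The statement is symmetric under `(p, B, D) ↔ (p', B^*, D^*)`, so only one implication is needed,
from `B D` on `L^p` to `B^* D^*` on `L^q`, where `1/p + 1/q = 1`. The adjoint of `B D` is not
`B^* D^*` but `D^* B^*`; the two are related through `B^*`, which must be inverted on the range
of `D^*`.

*The bounded operator that inverts `B^*`.* With the resolvents `R_l = (I + l B D)⁻¹`, the operators
`l D R_l` are bounded uniformly for `l = i t`, `t ≥ 1`, because `B (l D R_l) = I - R_l` and `B` is
bounded below on the range of `D`. A weak limit `S` of their adjoints as `t → ∞` satisfies
`D^* (I - B^* S) = 0`, and `S B^* z = z` for `z` in the range of `D^*`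
(`exists_dual_coprojection`). The second identity says that `B^*` is bounded below on the range
of `D^*`. The first one gives the resolvents of `B^* D^*`,
`(I + conj l • B^* D^*)⁻¹ = I - B^* S + B^* R_l^* S` (`isBoundedInverse_dual`). Bisectoriality on the dual
side, with the same angle, can be read off from this formula.

*R-bisectoriality.* Square function estimates for the family `R_l` pass to the adjoints by
duality of `L^p(ℂᴺ ⊗ ℓ²)` (`squareFunctionNorm_dualAdjoint_le`), and the single operators `B^*`,
`S` satisfy square function estimates by the Marcinkiewicz–Zygmund theorem
(`exists_squareFunctionNorm_apply_le`), proved with Gaussian averages.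

*Concrete input.* Adjoints on `L^q` and weak limits need the Riesz representation theorem for
`L^p` (`lpPair_surjective`), which is proved from the Radon–Nikodym theorem for signed measures. That
`D^*` with its distributional domain in `L^q` is the full adjoint of `D` in `L^p`
(`FirstOrderOp.mem_graph_adjoint_iff`) is shown by mollification; since translations act
continuously on `L^p`, no cut-off is needed.
-/

noncomputable section

namespace DiracLp

open Filter Topology ComplexConjugate ProbabilityTheory

/-! ### Dominated convergence and functionals on real `L^p` -/

section LpDual

variable {α : Type*} [MeasurableSpace α] {μ : Measure α}

/-- Dominated convergence in `L^p`. -/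
theorem tendsto_eLpNorm_sub_of_dominated {E ι : Type*} [NormedAddCommGroup E] {l : Filter ι}
    [l.IsCountablyGenerated] {p : ℝ≥0∞} (hp0 : p ≠ 0) (hp : p ≠ ∞) {F : ι → α → E} {f : α → E}
    {G : α → ℝ} (hF : ∀ i, AEStronglyMeasurable (F i) μ) (hf : AEStronglyMeasurable f μ)
    (hG : MemLp G p μ) (hFG : ∀ i, ∀ᵐ x ∂μ, ‖F i x‖ ≤ G x) (hfG : ∀ᵐ x ∂μ, ‖f x‖ ≤ G x)
    (hlim : ∀ᵐ x ∂μ, Tendsto (fun i => F i x) l (𝓝 (f x))) :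
    Tendsto (fun i => eLpNorm (F i - f) p μ) l (𝓝 0) := by
  have hpos : 0 < p.toReal := ENNReal.toReal_pos hp0 hp
  simp only [eLpNorm_eq_lintegral_rpow_enorm_toReal hp0 hp]
  have hb : ∫⁻ x, (2 * ‖G x‖ₑ) ^ p.toReal ∂μ ≠ ∞ := by
    simp only [ENNReal.mul_rpow_of_nonneg _ _ hpos.le]
    rw [lintegral_const_mul' _ _ (by finiteness)]
    exact ENNReal.mul_ne_top (by finiteness)
      (lintegral_rpow_enorm_lt_top_of_eLpNorm_lt_top hp0 hp hG.2).ne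
  have h := tendsto_lintegral_filter_of_dominated_convergence' (μ := μ) (l := l)
    (F := fun i x => ‖(F i - f) x‖ₑ ^ p.toReal) (f := fun _ => 0)
    (fun x => (2 * ‖G x‖ₑ) ^ p.toReal)
    (Eventually.of_forall fun i => (((hF i).sub hf).enorm.pow_const _)) ?_ hb ?_
  · have := h.ennrpow_const (1 / p.toReal)
    simpa [hpos, hpos.ne'] using this
  · refine Eventually.of_forall fun i => ?_
    filter_upwards [hFG i, hfG] with x h1 h2
    refine ENNReal.rpow_le_rpow ?_ hpos.le
    have : ∀ e : E, ‖e‖ ≤ G x → ‖e‖ₑ ≤ ‖G x‖ₑ := fun e he => by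
      rw [← ofReal_norm, ← ofReal_norm]
      exact ENNReal.ofReal_le_ofReal (he.trans (le_abs_self _))
    calc ‖(F i - f) x‖ₑ ≤ ‖F i x‖ₑ + ‖f x‖ₑ := enorm_sub_le
      _ ≤ ‖G x‖ₑ + ‖G x‖ₑ := add_le_add (this _ h1) (this _ h2)
      _ = _ := (two_mul _).symm
  · filter_upwards [hlim] with x hx
    have h1 : Tendsto (fun i => F i x - f x) l (𝓝 0) := by simpa using hx.sub_const (f x)
    have h2 := (h1.enorm).ennrpow_const p.toReal
    simpa [hpos] using h2

/-- The value of a functional on `L^p` at the class of a function, zero if the function is not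
in `L^p`. -/
def evalFun {p : ℝ≥0∞} [Fact (1 ≤ p)] (L : Lp ℝ p μ →L[ℝ] ℝ) (f : α → ℝ) : ℝ :=
  open Classical in if h : MemLp f p μ then L (h.toLp f) else 0

section evalFun

variable {p : ℝ≥0∞} [Fact (1 ≤ p)] (L : Lp ℝ p μ →L[ℝ] ℝ)

theorem evalFun_of_memLp {f : α → ℝ} (hf : MemLp f p μ) : evalFun L f = L (hf.toLp f) :=
  dif_pos hf

theorem evalFun_coe (f : Lp ℝ p μ) : evalFun L f = L f := by
  rw [evalFun_of_memLp L (Lp.memLp f), Lp.toLp_coeFn]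

theorem evalFun_add {f g : α → ℝ} (hf : MemLp f p μ) (hg : MemLp g p μ) :
    evalFun L (f + g) = evalFun L f + evalFun L g := by
  rw [evalFun_of_memLp L hf, evalFun_of_memLp L hg, evalFun_of_memLp L (hf.add hg),
    MemLp.toLp_add, map_add]

theorem evalFun_const_mul {f : α → ℝ} (hf : MemLp f p μ) (c : ℝ) :
    evalFun L (fun x => c * f x) = c * evalFun L f := by
  rw [evalFun_of_memLp L hf, evalFun_of_memLp L (f := fun x => c * f x) (hf.const_mul c)]
  exact (congrArg L (MemLp.toLp_const_smul c hf)).trans (L.map_smul c _)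

theorem evalFun_zero : evalFun L (fun _ => 0) = 0 := by
  simpa using evalFun_const_mul L (MemLp.zero (p := p) (μ := μ) (ε := ℝ)) 0

theorem evalFun_sum {ι : Type*} (s : Finset ι) {f : ι → α → ℝ} (hf : ∀ i, MemLp (f i) p μ) :
    evalFun L (fun x => ∑ i ∈ s, f i x) = ∑ i ∈ s, evalFun L (f i) := by
  classical
  induction s using Finset.induction_on with
  | empty => simpa using evalFun_zero L
  | insert a s ha ih =>
    simp only [Finset.sum_insert ha]
    rw [← ih]
    exact evalFun_add L (hf a) (memLp_finsetSum s fun i _ => hf i)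

theorem evalFun_congr {f g : α → ℝ} (h : f =ᵐ[μ] g) : evalFun L f = evalFun L g := by
  by_cases hf : MemLp f p μ
  · rw [evalFun_of_memLp L hf, evalFun_of_memLp L (hf.ae_eq h)]
    congr 1
    exact (MemLp.toLp_eq_toLp_iff _ _).2 h
  · have hg : ¬ MemLp g p μ := fun hg => hf (hg.ae_eq h.symm)
    rw [evalFun, evalFun, dif_neg hf, dif_neg hg]

theorem norm_evalFun_le {f : α → ℝ} (hf : MemLp f p μ) :
    |evalFun L f| ≤ ‖L‖ * (eLpNorm f p μ).toReal := by
  rw [evalFun_of_memLp L hf]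
  refine (L.le_opNorm _).trans ?_
  rw [Lp.norm_toLp]

theorem tendsto_evalFun_of_dominated {ι : Type*} {l : Filter ι} [l.IsCountablyGenerated]
    (hp : p ≠ ∞) {F : ι → α → ℝ} {f : α → ℝ} {G : α → ℝ}
    (hF : ∀ i, AEStronglyMeasurable (F i) μ) (hf : AEStronglyMeasurable f μ)
    (hG : MemLp G p μ) (hFG : ∀ i, ∀ᵐ x ∂μ, ‖F i x‖ ≤ G x) (hfG : ∀ᵐ x ∂μ, ‖f x‖ ≤ G x)
    (hlim : ∀ᵐ x ∂μ, Tendsto (fun i => F i x) l (𝓝 (f x))) :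
    Tendsto (fun i => evalFun L (F i)) l (𝓝 (evalFun L f)) := by
  have hF' : ∀ i, MemLp (F i) p μ := fun i => hG.of_le (hF i) ((hFG i).mono fun x hx =>
    hx.trans (le_abs_self _))
  have hf' : MemLp f p μ := hG.of_le hf (hfG.mono fun x hx => hx.trans (le_abs_self _))
  rw [evalFun_of_memLp L hf']
  simp only [fun i => evalFun_of_memLp L (hF' i)]
  refine (L.continuous.tendsto _).comp ?_
  rw [Lp.tendsto_Lp_iff_tendsto_eLpNorm'']
  exact tendsto_eLpNorm_sub_of_dominated (zero_lt_one.trans_le Fact.out).ne' hp hF hf hG hFG hfG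
    hlim

/-- A functional `L` on `L^p`, weighted by a function `W` in `L^p`, is a signed measure
`A ↦ L (1_A W)`, absolutely continuous with respect to `μ`; its density represents `L` on the
bounded multiples of `W`. -/
theorem exists_density_weighted [SigmaFinite μ] (hp : p ≠ ∞) {W : α → ℝ} (hW : MemLp W p μ) :
    ∃ g : α → ℝ, Measurable g ∧ Integrable g μ ∧ ∀ (h : α → ℝ) (c : ℝ), Measurable h →
      (∀ x, |h x| ≤ c) → evalFun L (fun x => h x * W x) = ∫ x, h x * g x ∂μ := by
  classical
  have hind : ∀ A, MeasurableSet A → MemLp (A.indicator W) p μ := fun A hA => hW.indicator hA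
  let ν : SignedMeasure α :=
    { measureOf' := fun A => if MeasurableSet A then evalFun L (A.indicator W) else 0
      empty' := by simpa using evalFun_zero L
      not_measurable' := fun A hA => if_neg hA
      m_iUnion' := by
        intro f hf hd
        simp only [hf, MeasurableSet.iUnion hf, if_true]
        unfold HasSum
        simp only [← evalFun_sum L _ (fun i => hind _ (hf i))]
        have hpt : ∀ x, (x ∉ ⋃ i, f i) ∨ ∃ j, x ∈ f j ∧ ∀ i, i ≠ j → x ∉ f i := by
          intro x
          by_cases hx : x ∈ ⋃ i, f i
          · obtain ⟨j, hj⟩ := Set.mem_iUnion.1 hx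
            exact Or.inr ⟨j, hj, fun i hi h => Set.disjoint_left.1 (hd hi) h hj⟩
          · exact Or.inl hx
        have hval : ∀ x j, x ∈ f j → (∀ i, i ≠ j → x ∉ f i) → ∀ s : Finset ℕ,
            ∑ i ∈ s, (f i).indicator W x = if j ∈ s then W x else 0 := by
          intro x j hj hne s
          rw [← Finset.sum_ite_eq' s j (fun _ => W x)]
          refine Finset.sum_congr rfl fun i _ => ?_
          by_cases hi : i = j
          · subst hi; simp [hj]
          · simp [hi, hne i hi]
        have hval0 : ∀ x, (x ∉ ⋃ i, f i) → ∀ s : Finset ℕ,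
            ∑ i ∈ s, (f i).indicator W x = 0 := by
          intro x hx s
          refine Finset.sum_eq_zero fun i _ => Set.indicator_of_notMem ?_ _
          exact fun h => hx (Set.mem_iUnion_of_mem i h)
        refine tendsto_evalFun_of_dominated L hp (G := fun x => |W x|)
          (fun s => (memLp_finsetSum s fun i _ => hind _ (hf i)).1)
          (hind _ (MeasurableSet.iUnion hf)).1 hW.abs ?_ ?_ ?_
        · refine fun s => Eventually.of_forall fun x => ?_
          rcases hpt x with hx | ⟨j, hj, hne⟩
          · simp [hval0 x hx]
          · rw [hval x j hj hne]
            split_ifs <;> simp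
        · refine Eventually.of_forall fun x => ?_
          exact norm_indicator_le_norm_self _ _
        · refine Eventually.of_forall fun x => ?_
          rcases hpt x with hx | ⟨j, hj, hne⟩
          · simp [hval0 x hx, hx]
          · refine tendsto_const_nhds.congr' ?_
            filter_upwards [eventually_ge_atTop {j}] with s hs
            rw [hval x j hj hne, if_pos (Finset.singleton_subset_iff.1 hs),
              Set.indicator_of_mem (Set.mem_iUnion_of_mem j hj)] }
  have hν : ∀ A, MeasurableSet A → ν A = evalFun L (A.indicator W) := fun A hA => if_pos hA
  have hac : ν ≪ᵥ μ.toENNRealVectorMeasure := by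
    refine VectorMeasure.AbsolutelyContinuous.mk fun A hA h0 => ?_
    rw [Measure.toENNRealVectorMeasure_apply_measurable hA] at h0
    rw [hν A hA, ← evalFun_zero L]
    refine evalFun_congr L ?_
    have : ∀ᵐ x ∂μ, x ∉ A := measure_eq_zero_iff_ae_notMem.1 h0
    filter_upwards [this] with x hx
    simp [hx]
  have hrn := SignedMeasure.withDensityᵥ_rnDeriv_eq ν μ hac
  have hgi := SignedMeasure.integrable_rnDeriv ν μ
  set g := ν.rnDeriv μ with hg
  have hset : ∀ A, MeasurableSet A → evalFun L (A.indicator W) = ∫ x in A, g x ∂μ := by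
    intro A hA
    rw [← hν A hA, ← hrn, withDensityᵥ_apply hgi hA]
  have hbm : ∀ (h : α → ℝ) (c : ℝ), Measurable h → (∀ x, |h x| ≤ c) →
      MemLp (fun x => h x * W x) p μ ∧ Integrable (fun x => h x * g x) μ := by
    intro h c hm hc
    have hc0 : ∀ x, |c| = c := fun x => abs_of_nonneg ((abs_nonneg _).trans (hc x))
    constructor
    · refine (hW.const_mul c).of_le (hm.aestronglyMeasurable.mul hW.1)
        (Eventually.of_forall fun x => ?_)
      rw [norm_mul, norm_mul, Real.norm_eq_abs c, hc0 x]
      exact mul_le_mul_of_nonneg_right (hc x) (norm_nonneg _)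
    · exact hgi.bdd_mul hm.aestronglyMeasurable (c := c) (Eventually.of_forall hc)
  have hsimple : ∀ s : SimpleFunc α ℝ, evalFun L (fun x => s x * W x) = ∫ x, s x * g x ∂μ := by
    intro s
    have hsb : ∀ s : SimpleFunc α ℝ, ∃ c, ∀ x, |s x| ≤ c := fun s => by
      obtain ⟨c, hc⟩ := s.exists_forall_norm_le
      exact ⟨c, hc⟩
    induction s using SimpleFunc.induction with
    | const c hA =>
      rename_i A
      have h1 : (fun x => (SimpleFunc.piecewise A hA (SimpleFunc.const α c)
          (SimpleFunc.const α 0)) x * W x) = fun x => c * A.indicator W x := by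
        ext x
        by_cases hx : x ∈ A <;> simp [hx]
      have h2 : (fun x => (SimpleFunc.piecewise A hA (SimpleFunc.const α c)
          (SimpleFunc.const α 0)) x * g x) = fun x => c * A.indicator g x := by
        ext x
        by_cases hx : x ∈ A <;> simp [hx]
      rw [h1, h2, evalFun_const_mul L (hind A hA), hset A hA, integral_const_mul,
        integral_indicator hA]
    | @add s t _ h1 h2 =>
      obtain ⟨c1, hc1⟩ := hsb s
      obtain ⟨c2, hc2⟩ := hsb t
      have e1 := hbm s c1 s.measurable hc1
      have e2 := hbm t c2 t.measurable hc2
      have e3 : (fun x => (s + t) x * W x) = (fun x => s x * W x) + fun x => t x * W x := by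
        ext x; simp [add_mul]
      have e4 : (fun x => (s + t) x * g x) = fun x => s x * g x + t x * g x := by
        ext x; simp [add_mul]
      rw [e3, e4, evalFun_add L e1.1 e2.1, integral_add e1.2 e2.2, h1, h2]
  refine ⟨g, SignedMeasure.measurable_rnDeriv _ _, hgi, fun h c hm hc => ?_⟩
  rcases isEmpty_or_nonempty α with hα | ⟨⟨x0⟩⟩
  · rw [evalFun_congr L (g := fun _ => 0) (Eventually.of_forall fun x => hα.elim x), evalFun_zero]
    simp [Measure.eq_zero_of_isEmpty μ]
  have hc0 : 0 ≤ c := (abs_nonneg _).trans (hc x0)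
  have hsm := hm.stronglyMeasurable
  let a := hsm.approxBounded c
  have ha : ∀ n x, ‖a n x‖ ≤ c := fun n x => hsm.norm_approxBounded_le hc0 n x
  have hlim : ∀ x, Tendsto (fun n => a n x) atTop (𝓝 (h x)) := fun x =>
    hsm.tendsto_approxBounded_of_norm_le (hc x)
  have t1 : Tendsto (fun n => evalFun L (fun x => a n x * W x)) atTop
      (𝓝 (evalFun L (fun x => h x * W x))) := by
    refine tendsto_evalFun_of_dominated L hp (G := fun x => c * ‖W x‖)
      (fun n => (a n).measurable.aestronglyMeasurable.mul hW.1)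
      (hm.aestronglyMeasurable.mul hW.1) (hW.norm.const_mul c) ?_ ?_ ?_
    · refine fun n => Eventually.of_forall fun x => ?_
      rw [norm_mul]
      exact mul_le_mul_of_nonneg_right (ha n x) (norm_nonneg _)
    · refine Eventually.of_forall fun x => ?_
      rw [norm_mul]
      exact mul_le_mul_of_nonneg_right (hc x) (norm_nonneg _)
    · exact Eventually.of_forall fun x => (hlim x).mul_const _
  have t2 : Tendsto (fun n => ∫ x, a n x * g x ∂μ) atTop (𝓝 (∫ x, h x * g x ∂μ)) := by
    refine tendsto_integral_of_dominated_convergence (fun x => c * ‖g x‖)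
      (fun n => (a n).measurable.aestronglyMeasurable.mul hgi.1) (hgi.norm.const_mul c) ?_ ?_
    · refine fun n => Eventually.of_forall fun x => ?_
      rw [norm_mul]
      exact mul_le_mul_of_nonneg_right (ha n x) (norm_nonneg _)
    · exact Eventually.of_forall fun x => (hlim x).mul_const _
  refine tendsto_nhds_unique t1 ?_
  simpa only [hsimple] using t2

end evalFun

end LpDual

/-! ### Riesz representation for real `L^p` -/

section LpDual

variable {α : Type*} [MeasurableSpace α] {μ : Measure α}

theorem eLpNorm_rpow_sub_one {E : Type*} [NormedAddCommGroup E] {p q : ℝ}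
    (hpq : p.HolderConjugate q) (f : α → E) :
    eLpNorm (fun x => ‖f x‖ ^ (q - 1)) (ENNReal.ofReal p) μ =
      eLpNorm f (ENNReal.ofReal q) μ ^ (q - 1) := by
  rw [eLpNorm_norm_rpow f (sub_pos.2 hpq.symm.lt), ← ENNReal.ofReal_mul hpq.pos.le]
  congr 3
  have := hpq.symm.sub_one_mul_conj
  linarith

theorem eLpNorm_rpow_self {E : Type*} [NormedAddCommGroup E] {q : ℝ}
    (hq : 0 < q) (f : α → E) :
    eLpNorm f (ENNReal.ofReal q) μ ^ q = ∫⁻ x, ‖f x‖ₑ ^ q ∂μ := by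
  rw [eLpNorm_eq_lintegral_rpow_enorm_toReal (by simpa using hq) ENNReal.ofReal_ne_top,
    ENNReal.toReal_ofReal hq.le, ← ENNReal.rpow_mul, one_div, inv_mul_cancel₀ hq.ne',
    ENNReal.rpow_one]

theorem le_of_rpow_le_mul_rpow {a c : ℝ≥0∞} {q : ℝ} (ha : a ≠ ∞)
    (h : a ^ q ≤ c * a ^ (q - 1)) : a ≤ c := by
  rcases eq_or_ne a 0 with h0 | h0
  · simp [h0]
  · have h2 : a ^ q = a * a ^ (q - 1) := by
      have := ENNReal.rpow_add 1 (q - 1) h0 ha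
      rw [ENNReal.rpow_one] at this
      rw [← this]
      congr 1
      ring
    rw [h2] at h
    refine (ENNReal.mul_le_mul_iff_left ?_ ?_).1 h
    · simp [ENNReal.rpow_eq_zero_iff, h0, ha]
    · simp [ENNReal.rpow_eq_top_iff, h0, ha]

/-- Every bounded functional on the real `L^p` space of a `σ`-finite measure, `1 < p < ∞`, is
integration against a function in `L^q`, where `1/p + 1/q = 1`. -/
theorem exists_real_representation [SigmaFinite μ] {p q : ℝ} (hpq : p.HolderConjugate q)
    [Fact (1 ≤ ENNReal.ofReal p)]
    (L : Lp ℝ (ENNReal.ofReal p) μ →L[ℝ] ℝ) :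
    ∃ g : α → ℝ, MemLp g (ENNReal.ofReal q) μ ∧
      ∀ f : Lp ℝ (ENNReal.ofReal p) μ, L f = ∫ x, g x * f x ∂μ := by
  have hp0 : 0 < p := hpq.pos
  have hP0 : ENNReal.ofReal p ≠ 0 := by simpa using hp0
  have hq0 : 0 < q := hpq.symm.pos
  have hPQ : ENNReal.HolderConjugate (ENNReal.ofReal p) (ENNReal.ofReal q) := hpq.ennrealOfReal
  obtain ⟨w, hw0, hwm, hw1⟩ := exists_pos_lintegral_lt_of_sigmaFinite μ one_ne_zero
  -- a strictly positive function `W` in `L^p`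
  set W : α → ℝ := fun x => (w x : ℝ) ^ (1 / p) with hWdef
  have hWpos : ∀ x, 0 < W x := fun x => Real.rpow_pos_of_pos (by exact_mod_cast hw0 x) _
  have hWm : Measurable W := by fun_prop
  have hW : MemLp W (ENNReal.ofReal p) μ := by
    refine ⟨hWm.aestronglyMeasurable, ?_⟩
    rw [eLpNorm_lt_top_iff_lintegral_rpow_enorm_lt_top hP0 ENNReal.ofReal_ne_top,
      ENNReal.toReal_ofReal hp0.le]
    refine lt_of_eq_of_lt ?_ (hw1.trans ENNReal.one_lt_top)
    refine lintegral_congr fun x => ?_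
    rw [← ofReal_norm, Real.norm_of_nonneg (hWpos x).le,
      ENNReal.ofReal_rpow_of_nonneg (hWpos x).le hp0.le, hWdef]
    simp only
    rw [← Real.rpow_mul (by positivity), one_div, inv_mul_cancel₀ hp0.ne', Real.rpow_one,
      ENNReal.ofReal_coe_nnreal]
  obtain ⟨g0, hg0m, hg0i, hg0⟩ := exists_density_weighted L ENNReal.ofReal_ne_top hW
  set g : α → ℝ := fun x => g0 x / W x with hg
  have hgm : Measurable g := hg0m.div hWm
  have key : ∀ (f : α → ℝ) (c : ℝ), Measurable f → (∀ x, |f x| ≤ c * W x) →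
      evalFun L f = ∫ x, g x * f x ∂μ := by
    intro f c hf hc
    have h1 := hg0 (fun x => f x / W x) c (hf.div hWm) (fun x => by
      rw [abs_div, abs_of_pos (hWpos x), div_le_iff₀ (hWpos x)]
      exact hc x)
    have h2 : (fun x => f x / W x * W x) = f := by
      ext x; exact div_mul_cancel₀ _ (hWpos x).ne'
    rw [h2] at h1
    rw [h1]
    refine integral_congr_ae (Eventually.of_forall fun x => ?_)
    simp only [hg]
    ring
  have hmem : ∀ (f : α → ℝ) (c : ℝ), Measurable f → (∀ x, |f x| ≤ c * W x) →
      MemLp f (ENNReal.ofReal p) μ := fun f c hf hc =>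
    (hW.const_mul c).of_le hf.aestronglyMeasurable (Eventually.of_forall fun x =>
      (hc x).trans (le_abs_self _))
  -- exhaustion of the space by the sets where `|f| ≤ n W`
  have hexh : ∀ f : α → ℝ, ∀ x, ∀ᶠ n : ℕ in atTop, x ∈ {x | |f x| ≤ n * W x} := by
    intro f x
    obtain ⟨m, hm⟩ := exists_nat_ge (|f x| / W x)
    filter_upwards [eventually_ge_atTop m] with n hn
    show |f x| ≤ n * W x
    rw [← div_le_iff₀ (hWpos x)]
    exact hm.trans (by exact_mod_cast hn)
  have hAm : ∀ f : α → ℝ, Measurable f → ∀ n : ℕ, MeasurableSet {x | |f x| ≤ n * W x} :=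
    fun f hf n => measurableSet_le hf.abs (hWm.const_mul _)
  have hind : ∀ f : α → ℝ, ∀ x, ∀ n : ℕ,
      |{x | |f x| ≤ n * W x}.indicator f x| ≤ n * W x := by
    intro f x n
    by_cases hx : x ∈ {x | |f x| ≤ n * W x}
    · rw [Set.indicator_of_mem hx]; exact hx
    · rw [Set.indicator_of_notMem hx, abs_zero]
      exact mul_nonneg (Nat.cast_nonneg _) (hWpos x).le
  have hlimind : ∀ (f k : α → ℝ) x, Tendsto (fun n : ℕ => {x | |f x| ≤ n * W x}.indicator k x)
      atTop (𝓝 (k x)) := by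
    intro f k x
    refine tendsto_const_nhds.congr' ?_
    filter_upwards [hexh f x] with n hn
    exact (Set.indicator_of_mem (s := {x | |f x| ≤ n * W x}) hn k).symm
  have hgq : MemLp g (ENNReal.ofReal q) μ := by
    refine ⟨hgm.aestronglyMeasurable, ?_⟩
    -- test with `f = sign g · |g|^{q-1}`, truncated to the sets where `|f| ≤ n W`; only there is
    -- the representation known so far
    set f : α → ℝ := fun x => SignType.sign (g x) * |g x| ^ (q - 1) with hf
    have hfm : Measurable f := by
      have : Measurable fun x => ((SignType.sign (g x) : SignType) : ℝ) := by
        have e : (fun x => ((SignType.sign (g x) : SignType) : ℝ)) = fun x =>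
            if 0 < g x then (1 : ℝ) else if g x < 0 then -1 else 0 := by
          ext x
          rcases lt_trichotomy (g x) 0 with h | h | h
          · simp [h, h.not_gt]
          · simp [h]
          · simp [h]
        rw [e]
        exact Measurable.ite (measurableSet_lt measurable_const hgm) measurable_const
          (Measurable.ite (measurableSet_lt hgm measurable_const) measurable_const
            measurable_const)
      exact this.mul (hgm.abs.pow_const _)
    have hfabs : ∀ x, |f x| = |g x| ^ (q - 1) := by
      intro x
      rcases eq_or_ne (g x) 0 with h | h
      · simp [hf, h, Real.zero_rpow (sub_pos.2 hpq.symm.lt).ne']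
      · have : |((SignType.sign (g x) : SignType) : ℝ)| = 1 := by
          rcases lt_or_gt_of_ne h with h | h <;> simp [h]
        rw [hf]
        simp only [abs_mul, this, one_mul]
        exact abs_of_nonneg (by positivity)
    have hgf : ∀ x, g x * f x = |g x| ^ q := by
      intro x
      simp only [hf]
      rw [← mul_assoc, mul_comm (g x), sign_mul_self, ← Real.rpow_one_add' (abs_nonneg _)]
      · congr 1; ring
      · have := hq0.ne'
        intro h; apply this; linarith
    set A : ℕ → Set α := fun n => {x | |f x| ≤ n * W x} with hA
    have hb : ∀ n, eLpNorm ((A n).indicator g) (ENNReal.ofReal q) μ ≤ ENNReal.ofReal ‖L‖ := by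
      intro n
      set gn := (A n).indicator g with hgn
      set fn := (A n).indicator f with hfn
      have hfnm : Measurable fn := hfm.indicator (hAm f hfm n)
      have hfn' : MemLp fn (ENNReal.ofReal p) μ := hmem fn n hfnm (fun x => hind f x n)
      have hnorm : eLpNorm fn (ENNReal.ofReal p) μ =
          eLpNorm gn (ENNReal.ofReal q) μ ^ (q - 1) := by
        rw [← eLpNorm_rpow_sub_one hpq]
        refine eLpNorm_congr_norm_ae (Eventually.of_forall fun x => ?_)
        by_cases hx : x ∈ A n
        · simp only [hfn, hgn, Set.indicator_of_mem hx, Real.norm_eq_abs, hfabs]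
          exact (abs_of_nonneg (by positivity)).symm
        · simp [hfn, hgn, Set.indicator_of_notMem hx,
            Real.zero_rpow (sub_pos.2 hpq.symm.lt).ne']
      set N := eLpNorm gn (ENNReal.ofReal q) μ with hN
      have hNtop : N ≠ ∞ := by
        intro h
        have := hfn'.2.ne
        rw [hnorm, h, ENNReal.top_rpow_of_pos (sub_pos.2 hpq.symm.lt)] at this
        exact this rfl
      have hint : ENNReal.ofReal (∫ x, g x * fn x ∂μ) = N ^ q := by
        rw [hN, eLpNorm_rpow_self hq0]
        have e : ∀ x, g x * fn x = ‖gn x‖ ^ q := by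
          intro x
          by_cases hx : x ∈ A n
          · simp only [hfn, hgn, Set.indicator_of_mem hx, Real.norm_eq_abs, hgf]
          · simp [hfn, hgn, Set.indicator_of_notMem hx, Real.zero_rpow hq0.ne']
        have hgnm : Measurable gn := hgm.indicator (hAm f hfm n)
        simp only [e]
        rw [integral_eq_lintegral_of_nonneg_ae (Eventually.of_forall fun x => by positivity)
          (hgnm.norm.pow_const q).aestronglyMeasurable, ENNReal.ofReal_toReal]
        · refine lintegral_congr fun x => ?_
          rw [← ENNReal.ofReal_rpow_of_nonneg (norm_nonneg _) hq0.le, ofReal_norm]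
        · have h3 : ∫⁻ x, ENNReal.ofReal (‖gn x‖ ^ q) ∂μ = N ^ q := by
            rw [hN, eLpNorm_rpow_self hq0]
            refine lintegral_congr fun x => ?_
            rw [← ENNReal.ofReal_rpow_of_nonneg (norm_nonneg _) hq0.le, ofReal_norm]
          rw [h3]
          exact ENNReal.rpow_ne_top_of_nonneg hq0.le hNtop
      have h1 : N ^ q ≤ ENNReal.ofReal ‖L‖ * N ^ (q - 1) := by
        rw [← hint, ← key fn n hfnm (fun x => hind f x n), ← hnorm,
          ← ENNReal.ofReal_toReal hfn'.2.ne, ← ENNReal.ofReal_mul (norm_nonneg _)]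
        exact ENNReal.ofReal_le_ofReal ((le_abs_self _).trans (norm_evalFun_le L hfn'))
      exact le_of_rpow_le_mul_rpow hNtop h1
    have hF := Lp.eLpNorm_lim_le_liminf_eLpNorm (p := ENNReal.ofReal q) (μ := μ)
      (f := fun n => (A n).indicator g)
      (fun n => (hgm.indicator (hAm f hfm n)).aestronglyMeasurable) g
      (Eventually.of_forall fun x => hlimind f g x)
    refine lt_of_le_of_lt (hF.trans ?_) (ENNReal.ofReal_lt_top (r := ‖L‖))
    exact (liminf_le_liminf (Eventually.of_forall hb)).trans (by simp)
  refine ⟨g, hgq, fun f => ?_⟩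
  rw [← evalFun_coe L f]
  set f' := (Lp.aestronglyMeasurable f).mk f with hf'
  have hff' : f =ᵐ[μ] f' := (Lp.aestronglyMeasurable f).ae_eq_mk
  have hfm : Measurable f' := (Lp.aestronglyMeasurable f).stronglyMeasurable_mk.measurable
  have hfp : MemLp f' (ENNReal.ofReal p) μ := (Lp.memLp f).ae_eq hff'
  rw [evalFun_congr L hff', integral_congr_ae (g := fun x => g x * f' x) (by
    filter_upwards [hff'] with x hx
    rw [hx])]
  have hgfi : Integrable (fun x => g x * f' x) μ := hgq.integrable_mul hfp
  have t1 : Tendsto (fun n : ℕ => evalFun L ({x | |f' x| ≤ n * W x}.indicator f')) atTop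
      (𝓝 (evalFun L f')) := by
    refine tendsto_evalFun_of_dominated L ENNReal.ofReal_ne_top (G := fun x => |f' x|)
      (fun n => (hfm.indicator (hAm f' hfm n)).aestronglyMeasurable) hfm.aestronglyMeasurable
      hfp.abs (fun n => Eventually.of_forall fun x => norm_indicator_le_norm_self _ _)
      (Eventually.of_forall fun x => le_rfl) (Eventually.of_forall fun x => hlimind f' f' x)
  have t2 : Tendsto (fun n : ℕ => ∫ x, g x * {x | |f' x| ≤ n * W x}.indicator f' x ∂μ) atTop
      (𝓝 (∫ x, g x * f' x ∂μ)) := by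
    refine tendsto_integral_of_dominated_convergence (fun x => ‖g x * f' x‖)
      (fun n => (hgm.mul (hfm.indicator (hAm f' hfm n))).aestronglyMeasurable) hgfi.norm
      (fun n => Eventually.of_forall fun x => ?_)
      (Eventually.of_forall fun x => (hlimind f' f' x).const_mul _)
    rw [norm_mul, norm_mul]
    exact mul_le_mul_of_nonneg_left (norm_indicator_le_norm_self _ _) (norm_nonneg _)
  refine tendsto_nhds_unique t1 ?_
  refine t2.congr fun n => ?_
  exact (key _ n (hfm.indicator (hAm f' hfm n)) (fun x => hind f' x n)).symm

end LpDual

/-! ### The duality of `L^p` and `L^q` for functions with values in `ℂᴺ` -/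

section NormingFun

variable {α H : Type*} [NormedAddCommGroup H] [InnerProductSpace ℂ H] {q : ℝ}

/-- The function `|v|^{q-2} v`, which norms `v` in `L^q` when it is tested in `L^p`. -/
def normingFun (q : ℝ) (v : α → H) (x : α) : H := ((‖v x‖ ^ (q - 2) : ℝ) : ℂ) • v x

theorem norm_normingFun (hq : 1 < q) (v : α → H) (x : α) :
    ‖normingFun q v x‖ = ‖v x‖ ^ (q - 1) := by
  rw [normingFun, norm_smul, Complex.norm_real, Real.norm_of_nonneg (by positivity)]
  rcases eq_or_ne (‖v x‖) 0 with h | h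
  · rw [h, mul_zero, Real.zero_rpow (sub_pos.2 hq).ne']
  · rw [← Real.rpow_add_one h]
    congr 1
    ring

end NormingFun

section Pairing

variable {α : Type*} [MeasurableSpace α] {μ : Measure α} {p q : ℝ}

section HilbertValued

variable {H : Type*} [NormedAddCommGroup H] [InnerProductSpace ℂ H]

theorem integrable_inner (hpq : p.HolderConjugate q) {v u : α → H}
    (hv : MemLp v (ENNReal.ofReal q) μ) (hu : MemLp u (ENNReal.ofReal p) μ) :
    Integrable (fun x => inner ℂ (v x) (u x)) μ := by
  have := hpq.symm.ennrealOfReal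
  exact memLp_one_iff_integrable.1 (MemLp.of_bilin (r := 1) (inner ℂ) 1 hv hu
    (hv.1.inner hu.1) (Eventually.of_forall fun x => by
      simpa using nnnorm_inner_le_nnnorm (𝕜 := ℂ) (v x) (u x)))

theorem lintegral_enorm_inner_le (hpq : p.HolderConjugate q) {v u : α → H}
    (hv : AEStronglyMeasurable v μ) (hu : AEStronglyMeasurable u μ) :
    ∫⁻ x, ‖(inner ℂ (v x) (u x) : ℂ)‖ₑ ∂μ ≤
      eLpNorm v (ENNReal.ofReal q) μ * eLpNorm u (ENNReal.ofReal p) μ := by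
  have := hpq.symm.ennrealOfReal
  have h1 := eLpNorm_le_eLpNorm_mul_eLpNorm_of_nnnorm (p := ENNReal.ofReal q)
    (q := ENNReal.ofReal p) (r := 1) hv hu (inner ℂ) 1 (Eventually.of_forall fun x => by
      simpa using nnnorm_inner_le_nnnorm (𝕜 := ℂ) (v x) (u x))
  rwa [ENNReal.coe_one, one_mul, eLpNorm_one_eq_lintegral_enorm] at h1

theorem enorm_integral_inner_le (hpq : p.HolderConjugate q) {v u : α → H}
    (hv : AEStronglyMeasurable v μ) (hu : AEStronglyMeasurable u μ) :
    ‖∫ x, inner ℂ (v x) (u x) ∂μ‖ₑ ≤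
      eLpNorm v (ENNReal.ofReal q) μ * eLpNorm u (ENNReal.ofReal p) μ :=
  (enorm_integral_le_lintegral_enorm _).trans (lintegral_enorm_inner_le hpq hv hu)

theorem aestronglyMeasurable_normingFun {v : α → H} (hv : AEStronglyMeasurable v μ) :
    AEStronglyMeasurable (normingFun q v) μ := by
  refine AEStronglyMeasurable.smul ?_ hv
  exact (Complex.measurable_ofReal.comp_aemeasurable
    (hv.norm.aemeasurable.pow_const _)).aestronglyMeasurable

theorem eLpNorm_normingFun (hpq : p.HolderConjugate q) (v : α → H) :
    eLpNorm (normingFun q v) (ENNReal.ofReal p) μ =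
      eLpNorm v (ENNReal.ofReal q) μ ^ (q - 1) := by
  rw [← eLpNorm_rpow_sub_one hpq]
  refine eLpNorm_congr_norm_ae (Eventually.of_forall fun x => ?_)
  rw [norm_normingFun hpq.symm.lt]
  exact (Real.norm_of_nonneg (by positivity)).symm

theorem memLp_normingFun (hpq : p.HolderConjugate q) {v : α → H}
    (hv : MemLp v (ENNReal.ofReal q) μ) :
    MemLp (normingFun q v) (ENNReal.ofReal p) μ := by
  refine ⟨aestronglyMeasurable_normingFun hv.1, ?_⟩
  rw [eLpNorm_normingFun hpq]
  exact ENNReal.rpow_lt_top_of_nonneg (sub_pos.2 hpq.symm.lt).le hv.2.ne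

theorem enorm_integral_inner_normingFun (hq : 1 < q) {v : α → H}
    (hv : MemLp v (ENNReal.ofReal q) μ) :
    ‖∫ x, inner ℂ (v x) (normingFun q v x) ∂μ‖ₑ = eLpNorm v (ENNReal.ofReal q) μ ^ q := by
  have hq0 : 0 < q := zero_lt_one.trans hq
  have h1 : ∀ x, inner ℂ (v x) (normingFun q v x) = ((‖v x‖ ^ q : ℝ) : ℂ) := by
    intro x
    rw [normingFun, inner_smul_right, inner_self_eq_norm_sq_to_K]
    rcases eq_or_ne (‖v x‖) 0 with h | h
    · simp [h, Real.zero_rpow hq0.ne']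
    · have : ‖v x‖ ^ q = ‖v x‖ ^ (q - 2) * ‖v x‖ ^ 2 := by
        rw [← Real.rpow_natCast, ← Real.rpow_add ((norm_nonneg _).lt_of_ne' h)]
        congr 1
        push_cast
        ring
      rw [this]
      push_cast
      rfl
  simp only [h1]
  rw [integral_complex_ofReal, ← ofReal_norm, Complex.norm_real, ofReal_norm,
    eLpNorm_rpow_self hq0, ← ofReal_norm, Real.norm_of_nonneg (integral_nonneg fun x => by positivity)]
  have e : ∀ x, ENNReal.ofReal (‖v x‖ ^ q) = ‖v x‖ₑ ^ q := fun x => by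
    rw [← ENNReal.ofReal_rpow_of_nonneg (norm_nonneg _) hq0.le, ofReal_norm]
  rw [integral_eq_lintegral_of_nonneg_ae (Eventually.of_forall fun x => by positivity)
    (hv.1.norm.aemeasurable.pow_const q).aestronglyMeasurable, ENNReal.ofReal_toReal]
  · exact lintegral_congr e
  · simp only [e]
    rw [← eLpNorm_rpow_self hq0]
    exact ENNReal.rpow_ne_top_of_nonneg hq0.le hv.2.ne

end HilbertValued

theorem Lp.coeFn_finsetSum {E ι : Type*} [NormedAddCommGroup E] {r : ℝ≥0∞} (s : Finset ι)
    (f : ι → Lp E r μ) : (∑ i ∈ s, f i : Lp E r μ) =ᵐ[μ] fun x => ∑ i ∈ s, f i x := by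
  classical
  induction s using Finset.induction_on with
  | empty => exact Lp.coeFn_zero E r μ
  | insert a s ha ih =>
    rw [Finset.sum_insert ha]
    filter_upwards [Lp.coeFn_add (f a) (∑ i ∈ s, f i), ih] with x h1 h2
    rw [h1, Pi.add_apply, h2, Finset.sum_insert ha]

variable {N : ℕ} [hP : Fact (1 ≤ ENNReal.ofReal p)] [hQ : Fact (1 ≤ ENNReal.ofReal q)]

/-- The sesquilinear pairing `(v, u) ↦ ∫ ⟨v, u⟩` of `L^q` and `L^p`, as a conjugate linear map
from `L^q` to the dual of `L^p`. -/
def lpPair (hpq : p.HolderConjugate q) :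
    Lp (CN N) (ENNReal.ofReal q) μ →L⋆[ℂ] StrongDual ℂ (Lp (CN N) (ENNReal.ofReal p) μ) :=
  LinearMap.mkContinuous₂ (LinearMap.mk₂'ₛₗ (starRingEnd ℂ) (RingHom.id ℂ)
    (fun v u => ∫ x, inner ℂ (v x) (u x) ∂μ)
    (fun v v' u => by
      rw [← integral_add (integrable_inner hpq (Lp.memLp v) (Lp.memLp u))
        (integrable_inner hpq (Lp.memLp v') (Lp.memLp u))]
      refine integral_congr_ae ?_
      filter_upwards [Lp.coeFn_add v v'] with x hx
      rw [hx, Pi.add_apply, inner_add_left])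
    (fun c v u => by
      rw [smul_eq_mul, ← integral_const_mul]
      refine integral_congr_ae ?_
      filter_upwards [Lp.coeFn_smul c v] with x hx
      rw [hx, Pi.smul_apply, inner_smul_left])
    (fun v u u' => by
      rw [← integral_add (integrable_inner hpq (Lp.memLp v) (Lp.memLp u))
        (integrable_inner hpq (Lp.memLp v) (Lp.memLp u'))]
      refine integral_congr_ae ?_
      filter_upwards [Lp.coeFn_add u u'] with x hx
      rw [hx, Pi.add_apply, inner_add_right])
    (fun c v u => by
      rw [RingHom.id_apply, smul_eq_mul, ← integral_const_mul]
      refine integral_congr_ae ?_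
      filter_upwards [Lp.coeFn_smul c u] with x hx
      rw [hx, Pi.smul_apply, inner_smul_right])) 1 (fun v u => by
    have h := ENNReal.toReal_mono (ENNReal.mul_ne_top (Lp.eLpNorm_ne_top v)
      (Lp.eLpNorm_ne_top u)) (enorm_integral_inner_le hpq (Lp.aestronglyMeasurable v)
        (Lp.aestronglyMeasurable u))
    rw [ENNReal.toReal_mul, ← Lp.norm_def, ← Lp.norm_def, toReal_enorm] at h
    simpa using h)

theorem lpPair_apply (hpq : p.HolderConjugate q) (v : Lp (CN N) (ENNReal.ofReal q) μ)
    (u : Lp (CN N) (ENNReal.ofReal p) μ) :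
    lpPair hpq v u = ∫ x, inner ℂ (v x) (u x) ∂μ := rfl

theorem norm_lpPair (hpq : p.HolderConjugate q) (v : Lp (CN N) (ENNReal.ofReal q) μ) :
    ‖lpPair hpq v‖ = ‖v‖ := by
  refine le_antisymm ?_ ?_
  · refine ContinuousLinearMap.opNorm_le_bound _ (norm_nonneg _) fun u => ?_
    rw [lpPair_apply]
    have h := ENNReal.toReal_mono (ENNReal.mul_ne_top (Lp.eLpNorm_ne_top v)
      (Lp.eLpNorm_ne_top u)) (enorm_integral_inner_le hpq (Lp.aestronglyMeasurable v)
        (Lp.aestronglyMeasurable u))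
    rwa [ENNReal.toReal_mul, ← Lp.norm_def, ← Lp.norm_def, toReal_enorm] at h
  · have hu := memLp_normingFun hpq (Lp.memLp v)
    set u := hu.toLp (normingFun q v) with hudef
    have h1 : ‖lpPair hpq v u‖ₑ = eLpNorm v (ENNReal.ofReal q) μ ^ q := by
      rw [← enorm_integral_inner_normingFun hpq.symm.lt (Lp.memLp v), lpPair_apply]
      congr 1
      refine integral_congr_ae ?_
      filter_upwards [hu.coeFn_toLp] with x hx
      rw [hudef, hx]
    have h2 : ‖lpPair hpq v u‖ₑ ≤
        ‖lpPair hpq v‖ₑ * eLpNorm v (ENNReal.ofReal q) μ ^ (q - 1) := by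
      have h3 : ‖u‖ₑ = eLpNorm v (ENNReal.ofReal q) μ ^ (q - 1) := by
        rw [Lp.enorm_def, eLpNorm_congr_ae hu.coeFn_toLp, eLpNorm_normingFun hpq]
      rw [← h3]
      exact (lpPair hpq v).le_opENorm u
    rw [h1] at h2
    have h4 := le_of_rpow_le_mul_rpow (Lp.eLpNorm_ne_top v) h2
    rw [← Lp.enorm_def] at h4
    exact enorm_le_iff_norm_le.1 h4

/-- The Riesz representation theorem for `L^p` of functions with values in `ℂᴺ`, `1 < p < ∞`,
deduced from the real one by coordinates. -/
theorem lpPair_surjective [SigmaFinite μ] (hpq : p.HolderConjugate q) :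
    Function.Surjective (lpPair (μ := μ) (N := N) hpq) := by
  intro φ
  let e : Fin N → ℝ →L[ℝ] CN N := fun i =>
    ContinuousLinearMap.toSpanSingleton ℝ (EuclideanSpace.single i (1 : ℂ))
  have he : ∀ i r, e i r = (r : ℂ) • EuclideanSpace.single i (1 : ℂ) := by
    intro i r
    simp [e, ContinuousLinearMap.toSpanSingleton_apply]
  let ι : Fin N → Lp ℝ (ENNReal.ofReal p) μ →L[ℝ] Lp (CN N) (ENNReal.ofReal p) μ := fun i =>
    (e i).compLpL (ENNReal.ofReal p) μ
  let φr : Lp (CN N) (ENNReal.ofReal p) μ →L[ℝ] ℂ := φ.restrictScalars ℝ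
  choose a ha haL using fun i => exists_real_representation hpq
    (Complex.reCLM.comp (φr.comp (ι i)))
  choose b hb hbL using fun i => exists_real_representation hpq
    (Complex.imCLM.comp (φr.comp (ι i)))
  have hφ : ∀ i f, φ (ι i f) = ∫ x, ((a i x : ℂ) + Complex.I * (b i x : ℂ)) * (f x : ℂ) ∂μ := by
    intro i f
    have h := hpq.symm.ennrealOfReal
    have i1 : Integrable (fun x => (((a i x * f x : ℝ)) : ℂ)) μ :=
      ((ha i).integrable_mul (Lp.memLp f)).ofReal
    have i2 : Integrable (fun x => (((b i x * f x : ℝ)) : ℂ)) μ :=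
      ((hb i).integrable_mul (Lp.memLp f)).ofReal
    have e1 : (φ (ι i f)).re = ∫ x, a i x * f x ∂μ := haL i f
    have e2 : (φ (ι i f)).im = ∫ x, b i x * f x ∂μ := hbL i f
    rw [← Complex.re_add_im (φ (ι i f)), e1, e2, ← integral_complex_ofReal,
      ← integral_complex_ofReal, ← integral_mul_const, ← integral_add i1 (i2.mul_const _)]
    refine integral_congr_ae (Eventually.of_forall fun x => ?_)
    push_cast
    ring
  let v : α → CN N := fun x => WithLp.toLp 2 fun i => (a i x : ℂ) - Complex.I * (b i x : ℂ)
  have hv : MemLp v (ENNReal.ofReal q) μ := by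
    refine MemLp.of_eval_piLp fun i => ?_
    exact ((ha i).ofReal (K := ℂ)).sub (((hb i).ofReal (K := ℂ)).const_mul Complex.I)
  refine ⟨hv.toLp v, ContinuousLinearMap.ext fun u => ?_⟩
  let re : Fin N → Lp (CN N) (ENNReal.ofReal p) μ →L[ℝ] Lp ℝ (ENNReal.ofReal p) μ := fun i =>
    (Complex.reCLM.comp
      ((EuclideanSpace.proj (𝕜 := ℂ) i).restrictScalars ℝ)).compLpL (ENNReal.ofReal p) μ
  let im : Fin N → Lp (CN N) (ENNReal.ofReal p) μ →L[ℝ] Lp ℝ (ENNReal.ofReal p) μ := fun i =>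
    (Complex.imCLM.comp
      ((EuclideanSpace.proj (𝕜 := ℂ) i).restrictScalars ℝ)).compLpL (ENNReal.ofReal p) μ
  have hre : ∀ i, re i u =ᵐ[μ] fun x => (u x i).re := fun i =>
    ContinuousLinearMap.coeFn_compLpL _ u
  have him : ∀ i, im i u =ᵐ[μ] fun x => (u x i).im := fun i =>
    ContinuousLinearMap.coeFn_compLpL _ u
  have hι : ∀ i f, ι i f =ᵐ[μ] fun x => (f x : ℂ) • EuclideanSpace.single i (1 : ℂ) := by
    intro i f
    filter_upwards [ContinuousLinearMap.coeFn_compLpL (e i) f] with x hx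
    exact hx.trans (he i _)
  have hu : u = ∑ i, (ι i (re i u) + Complex.I • ι i (im i u)) := by
    refine Lp.ext ?_
    have hall : ∀ᵐ x ∂μ, ∀ i, (ι i (re i u) + Complex.I • ι i (im i u) :
        Lp (CN N) (ENNReal.ofReal p) μ) x = (u x i) • EuclideanSpace.single i (1 : ℂ) := by
      refine ae_all_iff.2 fun i => ?_
      filter_upwards [Lp.coeFn_add (ι i (re i u)) (Complex.I • ι i (im i u)),
        Lp.coeFn_smul Complex.I (ι i (im i u)), hι i (re i u), hι i (im i u), hre i, him i]
        with x h1 h2 h3 h4 h5 h6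
      rw [h1, Pi.add_apply, h2, Pi.smul_apply, h3, h4, h5, h6, smul_smul, ← add_smul, mul_comm,
        Complex.re_add_im]
    filter_upwards [Lp.coeFn_finsetSum Finset.univ
      fun i => (ι i (re i u) + Complex.I • ι i (im i u)), hall] with x h1 h2
    rw [h1]
    simp only [h2]
    ext j
    simp [Finset.sum_apply, Pi.single_apply]
  have hI : ∀ i, Integrable (fun x => ((a i x : ℂ) + Complex.I * (b i x : ℂ)) * (u x i)) μ ∧
      φ (ι i (re i u) + Complex.I • ι i (im i u)) =
        ∫ x, ((a i x : ℂ) + Complex.I * (b i x : ℂ)) * (u x i) ∂μ := by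
    intro i
    have h := hpq.symm.ennrealOfReal
    have hg : MemLp (fun x => (a i x : ℂ) + Complex.I * (b i x : ℂ)) (ENNReal.ofReal q) μ :=
      ((ha i).ofReal (K := ℂ)).add (((hb i).ofReal (K := ℂ)).const_mul Complex.I)
    have i1 : Integrable (fun x => ((a i x : ℂ) + Complex.I * (b i x : ℂ)) * (re i u x : ℂ)) μ :=
      hg.integrable_mul ((Lp.memLp (re i u)).ofReal (K := ℂ))
    have i2 : Integrable (fun x => ((a i x : ℂ) + Complex.I * (b i x : ℂ)) * (im i u x : ℂ)) μ :=
      hg.integrable_mul ((Lp.memLp (im i u)).ofReal (K := ℂ))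
    have heq : (fun x => ((a i x : ℂ) + Complex.I * (b i x : ℂ)) * (re i u x : ℂ) +
        Complex.I * (((a i x : ℂ) + Complex.I * (b i x : ℂ)) * (im i u x : ℂ))) =ᵐ[μ]
        fun x => ((a i x : ℂ) + Complex.I * (b i x : ℂ)) * (u x i) := by
      filter_upwards [hre i, him i] with x h5 h6
      rw [h5, h6]
      conv_rhs => rw [← Complex.re_add_im (u x i)]
      ring
    refine ⟨(i1.add (i2.const_mul Complex.I)).congr heq, ?_⟩
    rw [map_add, map_smul, hφ, hφ, ← integral_congr_ae heq, integral_add i1 (i2.const_mul _),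
      integral_const_mul, smul_eq_mul]
  rw [lpPair_apply]
  conv_rhs => rw [hu, map_sum]
  simp only [fun i => (hI i).2]
  rw [← integral_finsetSum _ fun i _ => (hI i).1]
  refine integral_congr_ae ?_
  filter_upwards [hv.coeFn_toLp] with x hx
  rw [hx, PiLp.inner_apply]
  refine Finset.sum_congr rfl fun i _ => ?_
  simp only [v, RCLike.inner_apply, map_sub, map_mul, Complex.conj_ofReal, Complex.conj_I]
  ring

/-- `L^q` is the antidual of `L^p`. -/
def lpDualEquiv [SigmaFinite μ] (hpq : p.HolderConjugate q) :
    Lp (CN N) (ENNReal.ofReal q) μ ≃L⋆[ℂ] StrongDual ℂ (Lp (CN N) (ENNReal.ofReal p) μ) :=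
  (LinearIsometryEquiv.ofSurjective
    (⟨(lpPair hpq).toLinearMap, norm_lpPair hpq⟩ :
      Lp (CN N) (ENNReal.ofReal q) μ →ₛₗᵢ[starRingEnd ℂ]
        StrongDual ℂ (Lp (CN N) (ENNReal.ofReal p) μ))
    (lpPair_surjective hpq)).toContinuousLinearEquiv

theorem lpDualEquiv_apply [SigmaFinite μ] (hpq : p.HolderConjugate q)
    (v : Lp (CN N) (ENNReal.ofReal q) μ) (u : Lp (CN N) (ENNReal.ofReal p) μ) :
    lpDualEquiv hpq v u = ∫ x, inner ℂ (v x) (u x) ∂μ := rfl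

end Pairing

/-! ### Duality for `B D` in an abstract pair of Banach spaces -/

section Duality

variable {X Y : Type*} [NormedAddCommGroup X] [NormedSpace ℂ X]
  [NormedAddCommGroup Y] [NormedSpace ℂ Y] (J : Y ≃L⋆[ℂ] StrongDual ℂ X)

/-- The adjoint on `Y` of a bounded operator on `X`, where `Y` is identified with the antidual
of `X` through `J`. -/
def dualAdjoint (R : X →L[ℂ] X) : Y →L[ℂ] Y :=
  (J.symm : StrongDual ℂ X →L⋆[ℂ] Y).comp
    ((ContinuousLinearMap.precomp ℂ R).comp (J : Y →L⋆[ℂ] StrongDual ℂ X))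

theorem dualAdjoint_apply (R : X →L[ℂ] X) (y : Y) (x : X) :
    J (dualAdjoint J R y) x = J y (R x) := by
  simp [dualAdjoint]

theorem exists_norm_dualAdjoint_le :
    ∃ K : ℝ, 0 ≤ K ∧ ∀ R : X →L[ℂ] X, ‖dualAdjoint J R‖ ≤ K * ‖R‖ := by
  refine ⟨‖(J.symm : StrongDual ℂ X →L⋆[ℂ] Y)‖ * ‖(J : Y →L⋆[ℂ] StrongDual ℂ X)‖, by positivity,
    fun R => ?_⟩
  refine ContinuousLinearMap.opNorm_le_bound _ (by positivity) fun y => ?_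
  calc ‖dualAdjoint J R y‖
      ≤ ‖(J.symm : StrongDual ℂ X →L⋆[ℂ] Y)‖ * ‖(J y).comp R‖ :=
        (J.symm : StrongDual ℂ X →L⋆[ℂ] Y).le_opNorm _
    _ ≤ ‖(J.symm : StrongDual ℂ X →L⋆[ℂ] Y)‖ *
        ((‖(J : Y →L⋆[ℂ] StrongDual ℂ X)‖ * ‖y‖) * ‖R‖) := by
      gcongr
      refine ((J y).opNorm_comp_le R).trans ?_
      gcongr
      exact (J : Y →L⋆[ℂ] StrongDual ℂ X).le_opNorm y
    _ = _ := by ring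

theorem eq_of_pairing_eq {y z : Y} (h : ∀ x, J y x = J z x) : y = z :=
  J.injective (ContinuousLinearMap.ext h)

/-- A bounded sequence of complex numbers converges along every ultrafilter. -/
theorem exists_tendsto_ultrafilter (U : Ultrafilter ℕ) (a : ℕ → ℂ) (K : ℝ)
    (h : ∀ n, ‖a n‖ ≤ K) : ∃ z, ‖z‖ ≤ K ∧ Tendsto a U (𝓝 z) := by
  obtain ⟨z, hz, hle⟩ := (isCompact_closedBall (0 : ℂ) K).ultrafilter_le_nhds (U.map a) (by
    simp only [le_principal_iff, Ultrafilter.mem_coe, Ultrafilter.mem_map]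
    exact Filter.univ_mem' (fun n => by simpa using h n))
  exact ⟨z, by simpa using hz, hle⟩

/-- A uniformly bounded sequence of operators on `X` has adjoints that converge, along an
ultrafilter and in the weak operator topology given by the pairing, to a bounded operator on `Y`.
Only the weak-* compactness of balls of the dual of `X` is behind this, in the form of
`exists_tendsto_ultrafilter`. -/
theorem exists_weakLimit_adjoint (U : Ultrafilter ℕ) (Q : ℕ → X →L[ℂ] X) (K : ℝ)
    (hK : ∀ n, ‖Q n‖ ≤ K) :
    ∃ S : Y →L[ℂ] Y, ∀ y x, Tendsto (fun n => J y (Q n x)) U (𝓝 (J (S y) x)) := by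
  have hb : ∀ y x n, ‖J y (Q n x)‖ ≤ (‖(J : Y →L⋆[ℂ] StrongDual ℂ X)‖ * K) * ‖y‖ * ‖x‖ := by
    intro y x n
    calc ‖J y (Q n x)‖ ≤ ‖J y‖ * ‖Q n x‖ := (J y).le_opNorm _
      _ ≤ (‖(J : Y →L⋆[ℂ] StrongDual ℂ X)‖ * ‖y‖) * (K * ‖x‖) := by
        gcongr
        · exact (J : Y →L⋆[ℂ] StrongDual ℂ X).le_opNorm y
        · exact (Q n).le_of_opNorm_le (hK n) x
      _ = _ := by ring
  choose L hLb hL using fun y x => exists_tendsto_ultrafilter U _ _ (hb y x)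
  let M : Y →ₗ⋆[ℂ] X →ₗ[ℂ] ℂ := LinearMap.mk₂'ₛₗ (starRingEnd ℂ) (RingHom.id ℂ) L
    (fun y y' x => tendsto_nhds_unique (hL _ _) (by simpa using (hL y x).add (hL y' x)))
    (fun c y x => tendsto_nhds_unique (hL _ _)
      (by simpa [map_smulₛₗ] using (hL y x).const_mul (conj c)))
    (fun y x x' => tendsto_nhds_unique (hL _ _) (by simpa using (hL y x).add (hL y x')))
    (fun c y x => tendsto_nhds_unique (hL _ _) (by simpa using (hL y x).const_mul c))
  let Mc : Y →L⋆[ℂ] StrongDual ℂ X := M.mkContinuous₂ _ hLb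
  refine ⟨(J.symm : StrongDual ℂ X →L⋆[ℂ] Y).comp Mc, fun y x => ?_⟩
  have : J (((J.symm : StrongDual ℂ X →L⋆[ℂ] Y).comp Mc) y) x = L y x := by
    simp only [ContinuousLinearMap.comp_apply, ContinuousLinearEquiv.coe_coe,
      ContinuousLinearEquiv.apply_symm_apply]
    rfl
  rw [this]
  exact hL y x

variable {J} {D : X →ₗ.[ℂ] X} {E : Y →ₗ.[ℂ] Y} {B : X →L[ℂ] X} {Bs : Y →L[ℂ] Y}

theorem IsBoundedInverse.smul {A : X →ₗ.[ℂ] X} {a b : ℂ} {R : X →L[ℂ] X}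
    (h : IsBoundedInverse A a b R) {c : ℂ} (hc : c ≠ 0) :
    IsBoundedInverse A (c * a) (c * b) (c⁻¹ • R) := by
  constructor
  · intro x
    obtain ⟨hx, e⟩ := h.1 x
    have hm : (c⁻¹ • R) x ∈ A.domain := A.domain.smul_mem _ hx
    refine ⟨hm, ?_⟩
    have e2 : A ⟨(c⁻¹ • R) x, hm⟩ = c⁻¹ • A ⟨R x, hx⟩ := A.map_smul c⁻¹ ⟨R x, hx⟩
    rw [e2]
    calc (c * a) • (c⁻¹ • R) x + (c * b) • c⁻¹ • A ⟨R x, hx⟩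
        = (c * c⁻¹) • (a • R x + b • A ⟨R x, hx⟩) := by
          simp only [smul_apply]; module
      _ = x := by rw [e, mul_inv_cancel₀ hc, one_smul]
  · intro x
    have e := h.2 x
    calc (c⁻¹ • R) ((c * a) • (x : X) + (c * b) • A x)
        = (c⁻¹ * c) • R (a • (x : X) + b • A x) := by
          simp only [smul_apply, map_add, map_smul]; module
      _ = x := by rw [e, inv_mul_cancel₀ hc, one_smul]

/-- An operator with a resolvent is closed: its graph is the set of `(u, f)` with
`u = (I + l A)⁻¹ (u + l f)`. -/
theorem IsBoundedInverse.isClosed {A : X →ₗ.[ℂ] X} {l : ℂ} (hl : l ≠ 0) {R : X →L[ℂ] X}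
    (h : IsBoundedInverse A 1 l R) : A.IsClosed := by
  have : (A.graph : Set (X × X)) = {w | R (w.1 + l • w.2) = w.1} := by
    ext ⟨u, f⟩
    simp only [SetLike.mem_coe, Set.mem_ofPred_eq]
    constructor
    · intro hw
      obtain ⟨x, hx1, hx2⟩ := A.mem_graph_iff.1 hw
      have := h.2 x
      simp only at hx1 hx2
      rw [← hx1, ← hx2]
      simpa using this
    · intro hw
      obtain ⟨hx, e⟩ := h.1 (u + l • f)
      refine A.mem_graph_iff.2 ⟨⟨R (u + l • f), hx⟩, hw, ?_⟩
      rw [one_smul] at e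
      have e' : l • A ⟨R (u + l • f), hx⟩ = l • f := by
        refine add_left_cancel (a := u) ?_
        exact (congrArg (· + _) hw.symm).trans e
      exact smul_right_injective X hl e'
  unfold LinearPMap.IsClosed
  rw [this]
  exact isClosed_eq (by fun_prop) (by fun_prop)

/-- The resolvents of `B D` at infinity yield a bounded operator `S` on the dual side with
`E (x - Bs (S x)) = 0` for all `x`, and `S (Bs z) = z` for `z` in the range of `E`.

The operators `Q n = l n • D (I + l n • B D)⁻¹` are bounded uniformly in `n`, since
`B (Q n) = I - (I + l n • B D)⁻¹` and `B` is bounded below on the range of `D`; `S` is a weak limit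
of their adjoints. -/
theorem exists_dual_coprojection
    (hBs : ∀ y x, J (Bs y) x = J y (B x))
    (hadj : ∀ y z, (y, z) ∈ E.graph ↔ ∀ u : D.domain, J z u = J y (D u))
    {c : ℝ} (hc : 0 < c) (hlow : ∀ u ∈ LinearMap.range D.toFun, c * ‖u‖ ≤ ‖B u‖)
    {l : ℕ → ℂ} (hl : ∀ n, l n ≠ 0) (hlim : Tendsto (fun n => (l n)⁻¹) atTop (𝓝 0))
    {R : ℕ → X →L[ℂ] X} (hR : ∀ n, IsBoundedInverse (B.toLinearMap.compPMap D) 1 (l n) (R n))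
    {C : ℝ} (hC : ∀ n, ‖R n‖ ≤ C) :
    ∃ S : Y →L[ℂ] Y, (∀ x, (x - Bs (S x), (0 : Y)) ∈ E.graph) ∧
      ∀ z ∈ LinearMap.range E.toFun, S (Bs z) = z := by
  have hdom : ∀ n x, R n x ∈ D.domain := fun n x => ((hR n).1 x).1
  have hres : ∀ n x, R n x + l n • B (D ⟨R n x, hdom n x⟩) = x := by
    intro n x
    obtain ⟨h, e⟩ := (hR n).1 x
    rw [one_smul] at e
    exact e
  have hinv : ∀ n (u : D.domain), R n (u + l n • B (D u)) = u := by
    intro n u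
    have := (hR n).2 u
    rw [one_smul] at this
    exact this
  let Ql : ℕ → X →ₗ[ℂ] X := fun n => l n • D.toFun ∘ₗ (R n).toLinearMap.codRestrict D.domain (hdom n)
  have hQl : ∀ n x, Ql n x = l n • D ⟨R n x, hdom n x⟩ := fun n x => rfl
  have hBQ : ∀ n x, B (Ql n x) = x - R n x := by
    intro n x
    rw [hQl, map_smul]
    exact eq_sub_of_add_eq' (hres n x)
  have hQb : ∀ n x, ‖Ql n x‖ ≤ (c⁻¹ * (1 + C)) * ‖x‖ := by
    intro n x
    have h1 : c * ‖Ql n x‖ ≤ ‖B (Ql n x)‖ := hlow _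
      (Submodule.smul_mem _ _ ⟨⟨R n x, hdom n x⟩, rfl⟩)
    have h2 : ‖x - R n x‖ ≤ (1 + C) * ‖x‖ := by
      calc ‖x - R n x‖ ≤ ‖x‖ + ‖R n x‖ := norm_sub_le _ _
        _ ≤ ‖x‖ + C * ‖x‖ := by gcongr; exact (R n).le_of_opNorm_le (hC n) x
        _ = _ := by ring
    rw [hBQ] at h1
    rw [mul_assoc, inv_mul_eq_div, le_div_iff₀ hc, mul_comm]
    exact h1.trans h2
  have hC0 : 0 ≤ C := (norm_nonneg _).trans (hC 0)
  have hK : 0 ≤ c⁻¹ * (1 + C) := by positivity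
  let Q : ℕ → X →L[ℂ] X := fun n => (Ql n).mkContinuous _ (hQb n)
  have hQ : ∀ n x, Q n x = l n • D ⟨R n x, hdom n x⟩ := fun n x => rfl
  have hQK : ∀ n, ‖Q n‖ ≤ c⁻¹ * (1 + C) := fun n => LinearMap.mkContinuous_norm_le _ hK _
  have hlimQ : ∀ u, Tendsto (fun n => (l n)⁻¹ • Q n u) atTop (𝓝 0) := by
    intro u
    refine squeeze_zero_norm (a := fun n => ‖(l n)⁻¹‖ * (c⁻¹ * (1 + C) * ‖u‖)) (fun n => ?_) ?_
    · rw [norm_smul]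
      gcongr
      exact hQb n u
    · simpa using hlim.norm.mul_const (c⁻¹ * (1 + C) * ‖u‖)
  have hDR : ∀ n x, D ⟨R n x, hdom n x⟩ = (l n)⁻¹ • Q n x := by
    intro n x
    rw [hQ, smul_smul, inv_mul_cancel₀ (hl n), one_smul]
  obtain ⟨S, hS⟩ := exists_weakLimit_adjoint J (hyperfilter ℕ) Q _ hQK
  have hU : ((hyperfilter ℕ : Ultrafilter ℕ) : Filter ℕ) ≤ atTop := Nat.hyperfilter_le_atTop
  refine ⟨S, fun x => ?_, ?_⟩
  · rw [hadj]
    intro u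
    -- `Q n (B (D u)) = D u - (l n)⁻¹ • Q n u`, because the resolvent commutes with `B D`.
    have hQB : ∀ n, Q n (B (D u)) = D u - (l n)⁻¹ • Q n u := by
      intro n
      have h1 : R n (B (D u)) = (l n)⁻¹ • ((u : X) - R n u) := by
        have := hinv n u
        rw [map_add, map_smul] at this
        rw [← eq_sub_of_add_eq' this, smul_smul, inv_mul_cancel₀ (hl n), one_smul]
      have h2 : (⟨R n (B (D u)), hdom n _⟩ : D.domain) =
          (l n)⁻¹ • (u - ⟨R n u, hdom n _⟩) := Subtype.ext h1
      rw [hQ, h2, LinearPMap.map_smul, LinearPMap.map_sub, smul_smul, mul_inv_cancel₀ (hl n),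
        one_smul, hDR]
    have h3 : J (S x) (B (D u)) = J x (D u) := by
      refine tendsto_nhds_unique (hS x (B (D u))) ?_
      simp only [hQB]
      have := ((J x).continuous.tendsto _).comp ((hlimQ u).const_sub (D u))
      rw [sub_zero] at this
      exact this.mono_left hU
    simp [map_sub, hBs, h3]
  · rintro z ⟨y, rfl⟩
    refine eq_of_pairing_eq J fun x => ?_
    refine tendsto_nhds_unique (hS _ x) ?_
    have hg : (((y : Y), E.toFun y) : Y × Y) ∈ E.graph := E.mem_graph y
    have h1 : ∀ n, J (Bs (E.toFun y)) (Q n x) =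
        J (E.toFun y) x - J (y : Y) ((l n)⁻¹ • Q n x) := by
      intro n
      have h2 := (hadj _ _).1 hg ⟨R n x, hdom n x⟩
      rw [hDR] at h2
      rw [hBs, ← h2]
      have : B (Q n x) = x - R n x := hBQ n x
      rw [this, map_sub]
    simp only [h1]
    have := ((J (y : Y)).continuous.tendsto _).comp (hlimQ x)
    have := (this.const_sub (J (E.toFun y) x)).mono_left hU
    simpa using this

/-- The resolvent of `Bs E` from the resolvent of `B D`, where `E` is the adjoint of `D` and `Bs`
the adjoint of `B`: the adjoint of `B D` is `E Bs`, and
`I - Bs S + Bs (I + l (E Bs))⁻¹ S` inverts `I + l (Bs E)`. -/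
theorem isBoundedInverse_dual
    (hBs : ∀ y x, J (Bs y) x = J y (B x))
    (hadj : ∀ y z, (y, z) ∈ E.graph ↔ ∀ u : D.domain, J z u = J y (D u))
    {S : Y →L[ℂ] Y} (hS : ∀ x, (x - Bs (S x), (0 : Y)) ∈ E.graph)
    {l : ℂ} (hl : l ≠ 0) {R : X →L[ℂ] X}
    (hR : IsBoundedInverse (B.toLinearMap.compPMap D) 1 l R) :
    IsBoundedInverse (Bs.toLinearMap.compPMap E) 1 (conj l)
      (ContinuousLinearMap.id ℂ Y - Bs.comp S + Bs.comp ((dualAdjoint J R).comp S)) := by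
  have hl' : conj l ≠ 0 := by simpa using hl
  have hinv : ∀ (u : D.domain), R (u + l • B (D u)) = u := by
    intro u
    have := hR.2 u
    rw [one_smul] at this
    exact this
  set G := ContinuousLinearMap.id ℂ Y - Bs.comp S + Bs.comp ((dualAdjoint J R).comp S) with hG
  have hgr : ∀ x, (G x, (conj l)⁻¹ • (S x - dualAdjoint J R (S x))) ∈ E.graph := by
    intro x
    have h1 : (Bs (dualAdjoint J R (S x)), (conj l)⁻¹ • (S x - dualAdjoint J R (S x)))
        ∈ E.graph := by
      rw [hadj]
      intro u
      have h2 := hinv u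
      rw [map_add, map_smul] at h2
      have h3 : R (B (D u)) = l⁻¹ • ((u : X) - R u) := by
        rw [← eq_sub_of_add_eq' h2, smul_smul, inv_mul_cancel₀ hl, one_smul]
      rw [hBs, dualAdjoint_apply, h3]
      simp [map_smulₛₗ, dualAdjoint_apply]
    have := E.graph.add_mem (hS x) h1
    simpa [hG] using this
  have hsum : ∀ x, ∃ h : G x ∈ E.domain, G x + conj l • Bs (E ⟨G x, h⟩) = x := by
    intro x
    obtain ⟨w, hw1, hw2⟩ := E.mem_graph_iff.1 (hgr x)
    simp only at hw1 hw2
    have hm : G x ∈ E.domain := hw1 ▸ w.2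
    refine ⟨hm, ?_⟩
    have : (⟨G x, hm⟩ : E.domain) = w := Subtype.ext hw1.symm
    rw [this, hw2, map_smul, smul_smul, mul_inv_cancel₀ hl', one_smul]
    simp [hG]
  have hinj : ∀ y : E.domain, (y : Y) + conj l • Bs (E y) = 0 → (y : Y) = 0 := by
    intro y hy
    have hz : E y = 0 := by
      refine eq_of_pairing_eq J fun x => ?_
      obtain ⟨hx, e⟩ := hR.1 x
      rw [one_smul] at e
      have h1 := (hadj _ _).1 (E.mem_graph y) ⟨R x, hx⟩
      have h2 := congrArg (fun v => J v (D ⟨R x, hx⟩)) hy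
      simp only [map_add, map_smulₛₗ, add_apply,
        smul_apply, hBs, map_zero, zero_apply] at h2
      have h3 : J (E y) x = J (E y) (R x) + l • J (E y) (B (D ⟨R x, hx⟩)) := by
        rw [← map_smul, ← map_add]
        exact congrArg _ e.symm
      rw [h3]
      have h1' : J (E y) (R x) = J (y : Y) (D ⟨R x, hx⟩) := h1
      rw [h1']
      simpa using h2
    simpa [hz] using hy
  constructor
  · intro x
    obtain ⟨h, e⟩ := hsum x
    refine ⟨h, ?_⟩
    rw [one_smul]
    exact e
  · intro y
    rw [one_smul]
    set x : Y := (y : Y) + conj l • (Bs.toLinearMap.compPMap E) y with hx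
    obtain ⟨h, e⟩ := hsum x
    let y' : E.domain := y
    have h4 : G x - (y : Y) = 0 := by
      refine hinj (⟨G x, h⟩ - y') ?_
      rw [LinearPMap.map_sub, map_sub, smul_sub]
      have hx' : x = (y' : Y) + conj l • Bs (E y') := hx
      calc ((⟨G x, h⟩ - y' : E.domain) : Y) +
            (conj l • Bs (E ⟨G x, h⟩) - conj l • Bs (E y'))
          = (G x + conj l • Bs (E ⟨G x, h⟩)) - ((y' : Y) + conj l • Bs (E y')) := by
            simp only [Submodule.coe_sub]; abel
        _ = 0 := by rw [e, ← hx', sub_self]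
    exact sub_eq_zero.1 h4

end Duality

/-! ### Square functions: duality and the Marcinkiewicz–Zygmund theorem -/

section SquareFunction

variable {α : Type*} [MeasurableSpace α] {μ : Measure α} {N k : ℕ}

/-- The square function norm is the norm in `L^r(ℂᴺ ⊗ ℓ²)`. -/
theorem squareFunctionNorm_eq {r : ℝ≥0∞} (u : Fin k → Lp (CN N) r μ) :
    squareFunctionNorm u = eLpNorm (fun x => WithLp.toLp 2 fun j => u j x) r μ := by
  refine eLpNorm_congr_norm_ae (Eventually.of_forall fun x => ?_)
  rw [Real.norm_of_nonneg (Real.sqrt_nonneg _), PiLp.norm_eq_of_L2]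

theorem memLp_toLp {r : ℝ≥0∞} (u : Fin k → Lp (CN N) r μ) :
    MemLp (fun x => WithLp.toLp 2 fun j => u j x) r μ :=
  MemLp.of_eval_piLp fun j => Lp.memLp (u j)

theorem squareFunctionNorm_ne_top {r : ℝ≥0∞} (u : Fin k → Lp (CN N) r μ) :
    squareFunctionNorm u ≠ ∞ := by
  rw [squareFunctionNorm_eq]
  exact (memLp_toLp u).2.ne

theorem squareFunctionNorm_add_le {r : ℝ≥0∞} [hr : Fact (1 ≤ r)] (u v : Fin k → Lp (CN N) r μ) :
    squareFunctionNorm (fun j => u j + v j) ≤ squareFunctionNorm u + squareFunctionNorm v := by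
  simp only [squareFunctionNorm_eq]
  refine le_of_eq_of_le ?_ (eLpNorm_add_le (memLp_toLp u).1 (memLp_toLp v).1 hr.out)
  refine eLpNorm_congr_ae ?_
  have : ∀ᵐ x ∂μ, ∀ j, (u j + v j : Lp (CN N) r μ) x = u j x + v j x :=
    ae_all_iff.2 fun j => Lp.coeFn_add (u j) (v j)
  filter_upwards [this] with x hx
  simp only [hx]
  rfl

theorem squareFunctionNorm_neg {r : ℝ≥0∞} (u : Fin k → Lp (CN N) r μ) :
    squareFunctionNorm (fun j => -u j) = squareFunctionNorm u := by
  have : ∀ᵐ x ∂μ, ∀ j, (-u j : Lp (CN N) r μ) x = -u j x :=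
    ae_all_iff.2 fun j => Lp.coeFn_neg (u j)
  refine eLpNorm_congr_ae ?_
  filter_upwards [this] with x hx
  simp only [hx, norm_neg]

theorem squareFunctionNorm_single {r : ℝ≥0∞} [hr : Fact (1 ≤ r)] (u : Lp (CN N) r μ) :
    squareFunctionNorm (fun _ : Fin 1 => u) = ‖u‖ₑ := by
  rw [Lp.enorm_def]
  refine eLpNorm_congr_norm_ae (Eventually.of_forall fun x => ?_)
  simp

/-- Square function estimates are inherited by adjoint families. The estimate is an operator norm
bound on `L^p(ℂᴺ ⊗ ℓ²)`, and the proof tests with the norming function of `L^q(ℂᴺ ⊗ ℓ²)`. -/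
theorem squareFunctionNorm_dualAdjoint_le [SigmaFinite μ] {p q : ℝ} (hpq : p.HolderConjugate q)
    [Fact (1 ≤ ENNReal.ofReal p)] [Fact (1 ≤ ENNReal.ofReal q)]
    {R : Fin k → Lp (CN N) (ENNReal.ofReal p) μ →L[ℂ] Lp (CN N) (ENNReal.ofReal p) μ} {C : ℝ≥0∞}
    (hR : ∀ u : Fin k → Lp (CN N) (ENNReal.ofReal p) μ,
      squareFunctionNorm (fun j => R j (u j)) ≤ C * squareFunctionNorm u)
    (v : Fin k → Lp (CN N) (ENNReal.ofReal q) μ) :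
    squareFunctionNorm (fun j => dualAdjoint (lpDualEquiv hpq) (R j) (v j)) ≤
      C * squareFunctionNorm v := by
  set w := fun j => dualAdjoint (lpDualEquiv hpq) (R j) (v j) with hw
  set W : α → PiLp 2 (fun _ : Fin k => CN N) := fun x => WithLp.toLp 2 fun j => w j x with hWdef
  have hW : MemLp W (ENNReal.ofReal q) μ := memLp_toLp w
  have hU := memLp_normingFun hpq hW
  have hUj : ∀ j, MemLp (fun x => normingFun q W x j) (ENNReal.ofReal p) μ :=
    fun j => hU.eval_piLp j
  let u : Fin k → Lp (CN N) (ENNReal.ofReal p) μ := fun j => (hUj j).toLp _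
  have hu : ∀ᵐ x ∂μ, ∀ j, u j x = normingFun q W x j :=
    ae_all_iff.2 fun j => (hUj j).coeFn_toLp
  have hsu : squareFunctionNorm u = squareFunctionNorm w ^ (q - 1) := by
    rw [squareFunctionNorm_eq, squareFunctionNorm_eq, ← eLpNorm_normingFun hpq]
    refine eLpNorm_congr_ae ?_
    filter_upwards [hu] with x hx
    simp only [hx]
    rfl
  have hsum : ∀ (a : Fin k → Lp (CN N) (ENNReal.ofReal q) μ)
      (b : Fin k → Lp (CN N) (ENNReal.ofReal p) μ),
      ∑ j, lpDualEquiv hpq (a j) (b j) = ∫ x, inner ℂ (WithLp.toLp 2 fun j => a j x :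
        PiLp 2 (fun _ : Fin k => CN N)) (WithLp.toLp 2 fun j => b j x) ∂μ := by
    intro a b
    simp only [lpDualEquiv_apply]
    rw [← integral_finsetSum _ fun j _ => integrable_inner hpq (Lp.memLp (a j)) (Lp.memLp (b j))]
    exact integral_congr_ae (Eventually.of_forall fun x => rfl)
  have h1 : ‖∑ j, lpDualEquiv hpq (w j) (u j)‖ₑ = squareFunctionNorm w ^ q := by
    rw [hsum, squareFunctionNorm_eq, ← enorm_integral_inner_normingFun hpq.symm.lt hW]
    congr 1
    refine integral_congr_ae ?_
    filter_upwards [hu] with x hx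
    simp only [hx]
    rfl
  have h2 : ‖∑ j, lpDualEquiv hpq (w j) (u j)‖ₑ ≤
      (C * squareFunctionNorm v) * squareFunctionNorm w ^ (q - 1) := by
    simp only [hw, dualAdjoint_apply]
    rw [hsum]
    refine (enorm_integral_inner_le hpq (memLp_toLp v).1 (memLp_toLp fun j => R j (u j)).1).trans ?_
    rw [← squareFunctionNorm_eq, ← squareFunctionNorm_eq]
    calc squareFunctionNorm v * squareFunctionNorm (fun j => R j (u j))
        ≤ squareFunctionNorm v * (C * squareFunctionNorm u) := by gcongr; exact hR u
      _ = _ := by rw [hsu]; ring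
  rw [h1] at h2
  exact le_of_rpow_le_mul_rpow (squareFunctionNorm_ne_top w) h2

/-! ### Gaussian averages and the square function of a bounded operator -/

/-- The `p`-th absolute moment of the standard real Gaussian. -/
def gaussianMoment (p : ℝ) : ℝ≥0∞ := ∫⁻ t, ‖t‖ₑ ^ p ∂(gaussianReal 0 1)

theorem gaussianMoment_ne_top {p : ℝ} (hp : 0 < p) : gaussianMoment p ≠ ∞ := by
  have h := memLp_id_gaussianReal' (μ := 0) (v := 1) (ENNReal.ofReal p) ENNReal.ofReal_ne_top
  have := lintegral_rpow_enorm_lt_top_of_eLpNorm_lt_top (by simpa using hp)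
    ENNReal.ofReal_ne_top h.2
  rw [ENNReal.toReal_ofReal hp.le] at this
  exact this.ne

theorem gaussianMoment_ne_zero {p : ℝ} (hp : 0 < p) : gaussianMoment p ≠ 0 := by
  intro h
  rw [gaussianMoment, lintegral_eq_zero_iff (by fun_prop)] at h
  have h1 : ∀ᵐ t ∂(gaussianReal 0 1), t = 0 := by
    filter_upwards [h] with t ht
    simpa [hp, hp.not_gt] using ht
  have h2 : ∀ᵐ t ∂(gaussianReal 0 1), t ≠ 0 := by
    have := nullSingletonClass_gaussianReal (μ := 0) (v := 1) one_ne_zero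
    rw [ae_iff]
    simp
  have h3 : ∀ᵐ t ∂(gaussianReal 0 1), False := by
    filter_upwards [h1, h2] with t a b using b a
  rw [eventually_false_iff_eq_bot, ae_eq_bot] at h3
  exact IsProbabilityMeasure.ne_zero _ h3

/-- A linear functional of norm `‖a‖` has, under the standard Gaussian measure, the law of `‖a‖`
times a standard real Gaussian. The constant does not depend on the dimension `k`. -/
theorem lintegral_inner_stdGaussian (p : ℝ) (hp : 0 ≤ p) (a : EuclideanSpace ℝ (Fin k)) :
    ∫⁻ t, ‖inner ℝ a t‖ₑ ^ p ∂(stdGaussian (EuclideanSpace ℝ (Fin k))) =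
      ‖a‖ₑ ^ p * gaussianMoment p := by
  have h := IsGaussian.map_eq_gaussianReal (μ := stdGaussian (EuclideanSpace ℝ (Fin k)))
    (innerSL ℝ a)
  rw [integral_strongDual_stdGaussian, variance_dual_stdGaussian, innerSL_apply_norm] at h
  have h2 := gaussianReal_map_const_mul (μ := 0) (v := 1) ‖a‖
  have h3 : (NNReal.mk (‖a‖ ^ 2) (sq_nonneg _) * 1) = (‖a‖ ^ 2).toNNReal := by
    rw [mul_one]
    exact (Real.toNNReal_of_nonneg (sq_nonneg _)).symm
  rw [mul_zero, h3, ← h] at h2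
  calc ∫⁻ t, ‖inner ℝ a t‖ₑ ^ p ∂(stdGaussian (EuclideanSpace ℝ (Fin k)))
      = ∫⁻ s, ‖s‖ₑ ^ p ∂((stdGaussian (EuclideanSpace ℝ (Fin k))).map (innerSL ℝ a)) := by
        rw [lintegral_map (by fun_prop) (by fun_prop)]
        rfl
    _ = ∫⁻ s, ‖‖a‖ * s‖ₑ ^ p ∂(gaussianReal 0 1) := by
        rw [← h2, lintegral_map (by fun_prop) (by fun_prop)]
    _ = _ := by
        simp only [enorm_mul, ENNReal.mul_rpow_of_nonneg _ _ hp, enorm_norm]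
        rw [lintegral_const_mul _ (by fun_prop), gaussianMoment]

/-- The `2N` real coordinates of a vector in `ℂᴺ`: real parts at `true`, imaginary parts at
`false`. -/
def realCoord (m : Fin N × Bool) (z : CN N) : ℝ := if m.2 then (z m.1).re else (z m.1).im

theorem norm_sq_eq_sum_realCoord (z : CN N) : ‖z‖ ^ 2 = ∑ m, realCoord m z ^ 2 := by
  rw [EuclideanSpace.norm_sq_eq, Fintype.sum_prod_type]
  refine Finset.sum_congr rfl fun i _ => ?_
  rw [Complex.sq_norm, Complex.normSq_apply]
  simp [realCoord]
  ring

theorem realCoord_sum (m : Fin N × Bool) (t : Fin k → ℝ) (w : Fin k → CN N) :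
    realCoord m (∑ j, (t j : ℂ) • w j) = ∑ j, t j * realCoord m (w j) := by
  unfold realCoord
  split_ifs <;> simp

theorem rpow_le_card_mul_sum {ι : Type*} [Fintype ι] {p : ℝ} (hp : 1 ≤ p) {s : ℝ} {a : ι → ℝ}
    (hs : 0 ≤ s) (h : s ^ 2 = ∑ m, a m ^ 2) :
    ‖s‖ₑ ^ p ≤ (Fintype.card ι : ℝ≥0∞) ^ (p - 1) * ∑ m, ‖a m‖ₑ ^ p := by
  have h1 : s ≤ ∑ m, |a m| := by
    refine abs_le_of_sq_le_sq' ?_ (Finset.sum_nonneg fun _ _ => abs_nonneg _) |>.2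
    rw [h]
    simpa using Finset.sum_sq_le_sq_sum_of_nonneg (s := Finset.univ) (f := fun m => |a m|)
      (fun _ _ => abs_nonneg _)
  have h2 : ‖s‖ₑ ≤ ∑ m, ‖a m‖ₑ := by
    rw [← ofReal_norm, Real.norm_of_nonneg hs]
    refine (ENNReal.ofReal_le_ofReal h1).trans ?_
    rw [ENNReal.ofReal_sum_of_nonneg fun _ _ => abs_nonneg _]
    exact (Finset.sum_congr rfl fun m _ => by rw [← ofReal_norm, Real.norm_eq_abs]).le
  refine (ENNReal.rpow_le_rpow h2 (by linarith)).trans ?_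
  exact ENNReal.rpow_sum_le_const_mul_sum_rpow Finset.univ _ hp

theorem sum_rpow_le_card_mul {ι : Type*} [Fintype ι] {p : ℝ} (hp : 0 ≤ p) {s : ℝ} {a : ι → ℝ}
    (hs : 0 ≤ s) (h : s ^ 2 = ∑ m, a m ^ 2) :
    ∑ m, ‖a m‖ₑ ^ p ≤ Fintype.card ι * ‖s‖ₑ ^ p := by
  have h1 : ∀ m, ‖a m‖ₑ ≤ ‖s‖ₑ := by
    intro m
    rw [enorm_le_iff_norm_le, Real.norm_of_nonneg hs, Real.norm_eq_abs]
    refine abs_le_of_sq_le_sq ?_ hs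
    rw [h]
    exact Finset.single_le_sum (f := fun m => a m ^ 2) (fun _ _ => sq_nonneg _)
      (Finset.mem_univ m)
  refine (Finset.sum_le_sum fun m _ => ENNReal.rpow_le_rpow (h1 m) hp).trans ?_
  rw [Finset.sum_const, nsmul_eq_mul, Finset.card_univ]

/-- The constant `(2N)^{p-1} 2N` in the comparison of Gaussian averages with square functions. -/
def gaussianConst (N : ℕ) (p : ℝ) : ℝ≥0∞ :=
  (Fintype.card (Fin N × Bool) : ℝ≥0∞) ^ (p - 1) * Fintype.card (Fin N × Bool)

theorem gaussianConst_ne_top {p : ℝ} (hp : 1 ≤ p) : gaussianConst N p ≠ ∞ :=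
  ENNReal.mul_ne_top (ENNReal.rpow_ne_top_of_nonneg (sub_nonneg.2 hp) (by finiteness))
    (by finiteness)

section Khintchine

variable {p : ℝ} (w : Fin k → CN N)

theorem norm_toLp_sq_eq : ‖(WithLp.toLp 2 w : PiLp 2 fun _ : Fin k => CN N)‖ ^ 2 =
    ∑ m, ‖(WithLp.toLp 2 fun j => realCoord m (w j) : EuclideanSpace ℝ (Fin k))‖ ^ 2 := by
  rw [PiLp.norm_sq_eq_of_L2]
  simp only [EuclideanSpace.real_norm_sq_eq, norm_sq_eq_sum_realCoord]
  exact Finset.sum_comm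

theorem lintegral_realCoord_stdGaussian (hp : 0 ≤ p) (m : Fin N × Bool) :
    ∫⁻ t, ‖realCoord m (∑ j, (t j : ℂ) • w j)‖ₑ ^ p
        ∂(stdGaussian (EuclideanSpace ℝ (Fin k))) =
      ‖(WithLp.toLp 2 fun j => realCoord m (w j) : EuclideanSpace ℝ (Fin k))‖ₑ ^ p *
        gaussianMoment p := by
  rw [← lintegral_inner_stdGaussian p hp]
  refine lintegral_congr fun t => ?_
  rw [realCoord_sum, PiLp.inner_apply]
  simp [mul_comm]

theorem measurable_realCoord_sum (m : Fin N × Bool) :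
    Measurable fun t : EuclideanSpace ℝ (Fin k) => realCoord m (∑ j, (t j : ℂ) • w j) := by
  simp only [realCoord_sum]
  fun_prop

theorem lintegral_gaussianSum_le (hp : 1 ≤ p) :
    ∫⁻ t, ‖∑ j, (t j : ℂ) • w j‖ₑ ^ p ∂(stdGaussian (EuclideanSpace ℝ (Fin k))) ≤
      gaussianConst N p * (gaussianMoment p *
        ‖(WithLp.toLp 2 w : PiLp 2 fun _ : Fin k => CN N)‖ₑ ^ p) := by
  have hp0 : 0 ≤ p := by linarith
  have h1 : ∀ t : EuclideanSpace ℝ (Fin k), ‖∑ j, (t j : ℂ) • w j‖ₑ ^ p ≤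
      (Fintype.card (Fin N × Bool) : ℝ≥0∞) ^ (p - 1) *
        ∑ m, ‖realCoord m (∑ j, (t j : ℂ) • w j)‖ₑ ^ p := by
    intro t
    have := rpow_le_card_mul_sum hp (norm_nonneg _)
      (norm_sq_eq_sum_realCoord (∑ j, (t j : ℂ) • w j))
    rwa [enorm_norm] at this
  refine (lintegral_mono h1).trans ?_
  rw [lintegral_const_mul _ (Finset.measurable_sum _ fun m _ =>
      ((measurable_realCoord_sum w m).enorm.pow_const _)),
    lintegral_finsetSum _ fun m _ => ((measurable_realCoord_sum w m).enorm.pow_const _)]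
  simp only [lintegral_realCoord_stdGaussian w hp0]
  have h2 := sum_rpow_le_card_mul hp0 (norm_nonneg _) (norm_toLp_sq_eq w)
  simp only [enorm_norm] at h2
  rw [← Finset.sum_mul]
  refine (mul_le_mul_right (mul_le_mul_left h2 _) _).trans_eq ?_
  rw [gaussianConst]
  ring

theorem le_lintegral_gaussianSum (hp : 1 ≤ p) :
    gaussianMoment p * ‖(WithLp.toLp 2 w : PiLp 2 fun _ : Fin k => CN N)‖ₑ ^ p ≤
      gaussianConst N p *
        ∫⁻ t, ‖∑ j, (t j : ℂ) • w j‖ₑ ^ p ∂(stdGaussian (EuclideanSpace ℝ (Fin k))) := by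
  have hp0 : 0 ≤ p := by linarith
  have h1 := rpow_le_card_mul_sum hp (norm_nonneg _) (norm_toLp_sq_eq w)
  simp only [enorm_norm] at h1
  have h2 : ∀ t : EuclideanSpace ℝ (Fin k),
      ∑ m, ‖realCoord m (∑ j, (t j : ℂ) • w j)‖ₑ ^ p ≤
        Fintype.card (Fin N × Bool) * ‖∑ j, (t j : ℂ) • w j‖ₑ ^ p := by
    intro t
    have := sum_rpow_le_card_mul hp0 (norm_nonneg _)
      (norm_sq_eq_sum_realCoord (∑ j, (t j : ℂ) • w j))
    rwa [enorm_norm] at this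
  have h3 := lintegral_mono (μ := stdGaussian (EuclideanSpace ℝ (Fin k))) h2
  rw [lintegral_finsetSum _ fun m _ => ((measurable_realCoord_sum w m).enorm.pow_const _),
    lintegral_const_mul' _ _ (by finiteness)] at h3
  simp only [lintegral_realCoord_stdGaussian w hp0] at h3
  rw [← Finset.sum_mul] at h3
  refine (mul_le_mul_right h1 _).trans ?_
  rw [gaussianConst, mul_comm, mul_assoc, mul_assoc]
  exact mul_le_mul_right h3 _

end Khintchine

/-- The theorem of Marcinkiewicz and Zygmund: a bounded operator on `L^p(ℂᴺ)` satisfies square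
function estimates. Up to constants, the square function is the Gaussian average of
`∑ j, t j u j`, which the operator maps to the one of its image. -/
theorem exists_squareFunctionNorm_apply_le [SigmaFinite μ] {p : ℝ}
    [hP : Fact (1 ≤ ENNReal.ofReal p)]
    (T : Lp (CN N) (ENNReal.ofReal p) μ →L[ℂ] Lp (CN N) (ENNReal.ofReal p) μ) :
    ∃ C : ℝ, 0 ≤ C ∧ ∀ (k : ℕ) (u : Fin k → Lp (CN N) (ENNReal.ofReal p) μ),
      squareFunctionNorm (fun j => T (u j)) ≤ ENNReal.ofReal C * squareFunctionNorm u := by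
  have hp : 1 ≤ p := ENNReal.one_le_ofReal.1 hP.out
  have hp0 : 0 < p := by linarith
  set K := gaussianConst N p with hK
  have hKtop : K ≠ ∞ := gaussianConst_ne_top hp
  have hg0 := gaussianMoment_ne_zero hp0
  have hgtop := gaussianMoment_ne_top hp0
  -- the average of `‖∑ j, t j u j‖ ^ p`, with the integrals over `x` and `t` exchanged
  have hswap : ∀ (k : ℕ) (u : Fin k → Lp (CN N) (ENNReal.ofReal p) μ),
      ∫⁻ x, ∫⁻ t, ‖∑ j, (t j : ℂ) • u j x‖ₑ ^ p ∂(stdGaussian (EuclideanSpace ℝ (Fin k))) ∂μ =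
      ∫⁻ t : EuclideanSpace ℝ (Fin k), ‖∑ j, (t j : ℂ) • u j‖ₑ ^ p
        ∂(stdGaussian (EuclideanSpace ℝ (Fin k))) := by
    intro k u
    have hm : StronglyMeasurable fun z : α × EuclideanSpace ℝ (Fin k) =>
        ∑ j, (z.2 j : ℂ) • u j z.1 := by
      refine Finset.stronglyMeasurable_fun_sum _ fun j _ => ?_
      refine StronglyMeasurable.smul (𝕜 := ℂ) ?_ ((Lp.stronglyMeasurable (u j)).comp_measurable
        measurable_fst)
      exact (by fun_prop : Measurable fun z : α × EuclideanSpace ℝ (Fin k) =>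
        (z.2 j : ℂ)).stronglyMeasurable
    rw [lintegral_lintegral_swap (hm.enorm.pow_const p).aemeasurable]
    refine lintegral_congr fun t => ?_
    rw [Lp.enorm_def, eLpNorm_rpow_self hp0]
    refine lintegral_congr_ae ?_
    have hs : ∀ᵐ x ∂μ, ∀ j, ((t j : ℂ) • u j : Lp (CN N) (ENNReal.ofReal p) μ) x =
        (t j : ℂ) • u j x := ae_all_iff.2 fun j => Lp.coeFn_smul _ _
    filter_upwards [Lp.coeFn_finsetSum Finset.univ fun j => (t j : ℂ) • u j, hs] with x h1 h2
    rw [h1]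
    simp only [h2]
  have hsq : ∀ (k : ℕ) (u : Fin k → Lp (CN N) (ENNReal.ofReal p) μ),
      squareFunctionNorm u ^ p = ∫⁻ x, ‖(WithLp.toLp 2 fun j => u j x :
        PiLp 2 fun _ : Fin k => CN N)‖ₑ ^ p ∂μ := by
    intro k u
    rw [squareFunctionNorm_eq, eLpNorm_rpow_self hp0]
  have hmain : ∀ (k : ℕ) (u : Fin k → Lp (CN N) (ENNReal.ofReal p) μ),
      squareFunctionNorm (fun j => T (u j)) ^ p ≤
        (K * ‖T‖ₑ ^ p * K) * squareFunctionNorm u ^ p := by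
    intro k u
    have h1 : gaussianMoment p * squareFunctionNorm (fun j => T (u j)) ^ p ≤
        K * ∫⁻ t : EuclideanSpace ℝ (Fin k), ‖∑ j, (t j : ℂ) • T (u j)‖ₑ ^ p
          ∂(stdGaussian (EuclideanSpace ℝ (Fin k))) := by
      rw [hsq, ← hswap, ← lintegral_const_mul' _ _ hgtop, ← lintegral_const_mul' _ _ hKtop]
      exact lintegral_mono fun x => le_lintegral_gaussianSum _ hp
    have h2 : ∫⁻ t : EuclideanSpace ℝ (Fin k), ‖∑ j, (t j : ℂ) • T (u j)‖ₑ ^ p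
          ∂(stdGaussian (EuclideanSpace ℝ (Fin k))) ≤
        ‖T‖ₑ ^ p * ∫⁻ t : EuclideanSpace ℝ (Fin k), ‖∑ j, (t j : ℂ) • u j‖ₑ ^ p
          ∂(stdGaussian (EuclideanSpace ℝ (Fin k))) := by
      rw [← lintegral_const_mul' _ _ (by finiteness)]
      refine lintegral_mono fun t => ?_
      have e : ∑ j, (t j : ℂ) • T (u j) = T (∑ j, (t j : ℂ) • u j) := by
        rw [map_sum]
        exact Finset.sum_congr rfl fun j _ => (T.map_smul _ _).symm
      rw [e, ← ENNReal.mul_rpow_of_nonneg _ _ hp0.le]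
      exact ENNReal.rpow_le_rpow (T.le_opENorm _) hp0.le
    have h3 : ∫⁻ t : EuclideanSpace ℝ (Fin k), ‖∑ j, (t j : ℂ) • u j‖ₑ ^ p
          ∂(stdGaussian (EuclideanSpace ℝ (Fin k))) ≤
        K * (gaussianMoment p * squareFunctionNorm u ^ p) := by
      rw [hsq, ← hswap, ← lintegral_const_mul' _ _ hgtop, ← lintegral_const_mul' _ _ hKtop]
      exact lintegral_mono fun x => lintegral_gaussianSum_le _ hp
    have h4 : gaussianMoment p * squareFunctionNorm (fun j => T (u j)) ^ p ≤
        gaussianMoment p * ((K * ‖T‖ₑ ^ p * K) * squareFunctionNorm u ^ p) := by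
      calc _ ≤ K * (‖T‖ₑ ^ p * (K * (gaussianMoment p * squareFunctionNorm u ^ p))) := by
            refine h1.trans ?_
            gcongr
            refine h2.trans ?_
            gcongr
        _ = _ := by ring
    exact (ENNReal.mul_le_mul_iff_right hg0 hgtop).1 h4
  have hctop : K * ‖T‖ₑ ^ p * K ≠ ∞ := by
    refine ENNReal.mul_ne_top (ENNReal.mul_ne_top hKtop ?_) hKtop
    exact ENNReal.rpow_ne_top_of_nonneg hp0.le (by finiteness)
  refine ⟨((K * ‖T‖ₑ ^ p * K) ^ (1 / p)).toReal, ENNReal.toReal_nonneg, fun k u => ?_⟩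
  rw [ENNReal.ofReal_toReal (ENNReal.rpow_ne_top_of_nonneg (by positivity) hctop)]
  rw [← ENNReal.rpow_le_rpow_iff hp0, ENNReal.mul_rpow_of_nonneg _ _ hp0.le, ← ENNReal.rpow_mul,
    one_div, inv_mul_cancel₀ hp0.ne', ENNReal.rpow_one]
  exact hmain k u

end SquareFunction

/-! ### `D^*` in `L^q` is the adjoint of `D` in `L^p` -/

theorem integral_inner_const {α : Type*} [MeasurableSpace α] {μ : Measure α} {N : ℕ}
    {g : α → CN N} (hg : Integrable g μ) (e : CN N) :
    ∫ x, inner ℂ (g x) e ∂μ = inner ℂ (∫ x, g x ∂μ) e := by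
  rw [← inner_conj_symm, ← integral_inner hg e, ← integral_conj]
  simp only [inner_conj_symm]

section Mollification

variable {n N : ℕ} {p q : ℝ}

/-- The kernel `ψ(t - x) ⟨a(x), b(t)⟩` whose integral over `ℝⁿ × ℝⁿ` is the pairing of `a` with a
mollification of `b`, and of a mollification of `a` with `b`. -/
def mollKernel (ψ : Rn n → ℝ) (a b : Rn n → CN N) (z : Rn n × Rn n) : ℂ :=
  (ψ (z.2 - z.1) : ℂ) * inner ℂ (a z.1) (b z.2)

variable {ψ : Rn n → ℝ}

theorem stronglyMeasurable_mollKernel {r r' : ℝ≥0∞} (hψ : Continuous ψ) (a : LqSpace n N r')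
    (b : LqSpace n N r) : StronglyMeasurable (mollKernel ψ a b) := by
  refine StronglyMeasurable.mul ?_ (((Lp.stronglyMeasurable a).comp_measurable
    measurable_fst).inner ((Lp.stronglyMeasurable b).comp_measurable measurable_snd))
  exact (by fun_prop : Continuous fun z : Rn n × Rn n =>
    (ψ (z.2 - z.1) : ℂ)).stronglyMeasurable

theorem measurePreserving_shear : MeasurePreserving (MeasurableEquiv.shearAddRight (Rn n))
    ((volume : Measure (Rn n)).prod volume) (volume.prod volume) :=
  measurePreserving_prod_add volume volume

variable [hP : Fact (1 ≤ ENNReal.ofReal p)] [hQ : Fact (1 ≤ ENNReal.ofReal q)]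

theorem integrable_mollKernel (hpq : p.HolderConjugate q) (hψ : Continuous ψ)
    (hc : HasCompactSupport ψ) (a : LqSpace n N (ENNReal.ofReal q))
    (b : LqSpace n N (ENNReal.ofReal p)) :
    Integrable (mollKernel ψ a b) (volume.prod volume) := by
  have hm := stronglyMeasurable_mollKernel hψ a b
  refine (measurePreserving_shear.integrable_comp_emb
    (MeasurableEquiv.shearAddRight (Rn n)).measurableEmbedding).1 ?_
  have hm' := hm.comp_measurable (MeasurableEquiv.shearAddRight (Rn n)).measurable
  refine ⟨hm'.aestronglyMeasurable, ?_⟩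
  unfold HasFiniteIntegral
  rw [lintegral_prod_symm _ hm'.enorm.aemeasurable]
  have hb : ∀ h : Rn n, ∫⁻ x, ‖(mollKernel ψ a b ∘ MeasurableEquiv.shearAddRight (Rn n)) (x, h)‖ₑ ≤
      ‖ψ h‖ₑ * (‖a‖ₑ * ‖b‖ₑ) := by
    intro h
    have e : ∀ x, ‖(mollKernel ψ a b ∘ MeasurableEquiv.shearAddRight (Rn n)) (x, h)‖ₑ =
        ‖ψ h‖ₑ * ‖(inner ℂ (a x) (b (x + h)) : ℂ)‖ₑ := by
      intro x
      have : (MeasurableEquiv.shearAddRight (Rn n)) (x, h) = (x, x + h) := rfl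
      rw [Function.comp_apply, this, mollKernel, enorm_mul, add_sub_cancel_left]
      congr 1
      rw [← ofReal_norm, Complex.norm_real, ofReal_norm]
    simp only [e]
    rw [lintegral_const_mul' _ _ (by finiteness)]
    gcongr
    have hmp := measurePreserving_add_right (volume : Measure (Rn n)) h
    refine (lintegral_enorm_inner_le hpq (Lp.aestronglyMeasurable a)
      ((Lp.aestronglyMeasurable b).comp_measurePreserving hmp)).trans_eq ?_
    rw [Lp.enorm_def, Lp.enorm_def, eLpNorm_comp_measurePreserving (Lp.aestronglyMeasurable b) hmp]
  refine (lintegral_mono hb).trans_lt ?_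
  rw [lintegral_mul_const' _ _ (by finiteness)]
  exact ENNReal.mul_lt_top (hψ.integrable_of_hasCompactSupport hc).2 (by finiteness)

theorem integral_mollKernel_eq_left (hpq : p.HolderConjugate q) (hψ : Continuous ψ)
    (hc : HasCompactSupport ψ) (a : LqSpace n N (ENNReal.ofReal q))
    (b : LqSpace n N (ENNReal.ofReal p)) :
    ∫ z, mollKernel ψ a b z ∂(volume.prod volume) =
      ∫ x, inner ℂ (a x) (∫ t, ψ (t - x) • b t) := by
  rw [integral_prod _ (integrable_mollKernel hpq hψ hc a b)]
  refine integral_congr_ae (Eventually.of_forall fun x => ?_)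
  have hi : Integrable fun t => ψ (t - x) • b t :=
    integrable_smul_Lp _ (hψ.comp (continuous_id.sub continuous_const))
      (hc.comp_homeomorph (Homeomorph.subRight x)) b
  simp only
  rw [← integral_inner hi]
  refine integral_congr_ae (Eventually.of_forall fun t => ?_)
  simp only [mollKernel]
  rw [← Complex.coe_smul, inner_smul_right]

theorem integral_mollKernel_eq_right (hpq : p.HolderConjugate q) (hψ : Continuous ψ)
    (hc : HasCompactSupport ψ) (a : LqSpace n N (ENNReal.ofReal q))
    (b : LqSpace n N (ENNReal.ofReal p)) :
    ∫ z, mollKernel ψ a b z ∂(volume.prod volume) =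
      ∫ t, inner ℂ (∫ x, ψ (t - x) • a x) (b t) := by
  rw [integral_prod_symm _ (integrable_mollKernel hpq hψ hc a b)]
  refine integral_congr_ae (Eventually.of_forall fun t => ?_)
  have hi : Integrable fun x => ψ (t - x) • a x :=
    integrable_smul_Lp _ (hψ.comp (continuous_const.sub continuous_id))
      (hc.comp_homeomorph (Homeomorph.subLeft t)) a
  simp only
  rw [← integral_inner_const hi]
  refine integral_congr_ae (Eventually.of_forall fun x => ?_)
  simp only [mollKernel]
  rw [← Complex.coe_smul, inner_smul_left, Complex.conj_ofReal]

/-- Mollifiers recover the pairing. The integral of the kernel is the mean, with weight `ψ`, of the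
pairings of `a` with the translates of `b`, and translation is continuous in `L^p`. -/
theorem tendsto_integral_mollKernel (hpq : p.HolderConjugate q)
    (a : LqSpace n N (ENNReal.ofReal q)) (b : LqSpace n N (ENNReal.ofReal p))
    {φ : ℕ → ContDiffBump (0 : Rn n)} (hφ : Tendsto (fun i => (φ i).rOut) atTop (𝓝 0)) :
    Tendsto (fun i => ∫ z, mollKernel ((φ i).normed volume) a b z ∂(volume.prod volume)) atTop
      (𝓝 (∫ x, inner ℂ (a x) (b x))) := by
  have : Fact (ENNReal.ofReal p ≠ ∞) := ⟨ENNReal.ofReal_ne_top⟩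
  let G : Rn n → ℂ := fun h => lpDualEquiv hpq a (DomAddAct.mk h +ᵥ b)
  have hGc : Continuous G := by
    refine (lpDualEquiv hpq a).continuous.comp ?_
    have h1 : Continuous fun h : Rn n => DomAddAct.mk h := DomAddAct.continuous_mk
    exact h1.vadd continuous_const
  have hG : ∀ h, G h = ∫ x, inner ℂ (a x) (b (x + h)) := by
    intro h
    simp only [G]
    rw [lpDualEquiv_apply]
    refine integral_congr_ae ?_
    filter_upwards [DomAddAct.vadd_Lp_ae_eq (DomAddAct.mk h) b] with x hx
    rw [hx]
    simp [add_comm]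
  have hG0 : ∫ x, inner ℂ (a x) (b x) = G (-0) := by
    rw [hG]
    simp
  have hval : ∀ i, ∫ z, mollKernel ((φ i).normed volume) a b z ∂(volume.prod volume) =
      (MeasureTheory.convolution ((φ i).normed volume) (fun h => G (-h))
        (ContinuousLinearMap.lsmul ℝ ℝ) volume) 0 := by
    intro i
    have hi := integrable_mollKernel hpq ((φ i).continuous_normed (μ := volume)) (φ i).hasCompactSupport_normed a b
    have hi' := (measurePreserving_shear.integrable_comp_emb
      (MeasurableEquiv.shearAddRight (Rn n)).measurableEmbedding).2 hi
    rw [← measurePreserving_shear.integral_comp'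
      (f := MeasurableEquiv.shearAddRight (Rn n)) (mollKernel ((φ i).normed volume) a b)]
    have := integral_prod_symm _ hi'
    simp only [Function.comp_def] at this
    rw [this, convolution]
    refine integral_congr_ae (Eventually.of_forall fun h => ?_)
    simp only [ContinuousLinearMap.lsmul_apply, zero_sub, neg_neg]
    rw [hG, ← Complex.coe_smul, smul_eq_mul, ← integral_const_mul]
    refine integral_congr_ae (Eventually.of_forall fun x => ?_)
    have e : (MeasurableEquiv.shearAddRight (Rn n)) (x, h) = (x, x + h) := rfl
    simp only [e, mollKernel, add_sub_cancel_left]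
  rw [hG0]
  simp only [hval]
  exact ContDiffBump.convolution_tendsto_right_of_continuous hφ
    (hGc.comp continuous_neg) (0 : Rn n)

end Mollification

section Adjoint

variable {n N : ℕ} {p q : ℝ} [hP : Fact (1 ≤ ENNReal.ofReal p)] [hQ : Fact (1 ≤ ENNReal.ofReal q)]
  (D : FirstOrderOp n N)

theorem FirstOrderOp.adjoint_adjoint : D.adjoint.adjoint = D := by
  cases D
  simp [FirstOrderOp.adjoint]

theorem mollKernel_adjoint_ae (ψ : Rn n → ℝ) (T : CN N →L[ℂ] CN N)
    (y : LqSpace n N (ENNReal.ofReal q)) (u : LqSpace n N (ENNReal.ofReal p)) :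
    ∫ z, mollKernel ψ ((ContinuousLinearMap.adjoint T).compLpL (ENNReal.ofReal q) volume y) u z
      ∂(volume.prod volume) =
    ∫ z, mollKernel ψ y (T.compLpL (ENNReal.ofReal p) volume u) z ∂(volume.prod volume) := by
  refine integral_congr_ae ?_
  filter_upwards [Measure.quasiMeasurePreserving_fst.ae
      (ContinuousLinearMap.coeFn_compLpL (ContinuousLinearMap.adjoint T) y),
    Measure.quasiMeasurePreserving_snd.ae (ContinuousLinearMap.coeFn_compLpL T u)] with z h1 h2
  simp only [mollKernel, h1, h2, ContinuousLinearMap.adjoint_inner_left]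

/-- Integration by parts for functions in the domains of `D` in `L^p` and `D^*` in `L^q`, by
mollification: both sides, with the kernel `ρ(t - x)`, are
`i ∑ j, ∬ ∂_j ρ(t - x) ⟨y(x), A_j u(t)⟩`. -/
theorem FirstOrderOp.WeakEq.integral_inner_eq (hpq : p.HolderConjugate q)
    {y z : LqSpace n N (ENNReal.ofReal q)} {u f : LqSpace n N (ENNReal.ofReal p)}
    (hyz : D.adjoint.WeakEq y z) (huf : D.WeakEq u f) :
    ∫ x, inner ℂ (z x) (u x) = ∫ x, inner ℂ (y x) (f x) := by
  have hmoll : ∀ ρ : Rn n → ℝ, ContDiff ℝ ((⊤ : ℕ∞) : WithTop ℕ∞) ρ → HasCompactSupport ρ →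
      ∫ w, mollKernel ρ z u w ∂(volume.prod volume) =
        ∫ w, mollKernel ρ y f w ∂(volume.prod volume) := by
    intro ρ hρ hc
    let dρ : Fin n → Rn n → ℝ := fun j x => fderiv ℝ ρ x (EuclideanSpace.single j 1)
    have hdc : ∀ j, Continuous (dρ j) := fun j => continuous_partial hρ _
    have hds : ∀ j, HasCompactSupport (dρ j) := fun j => hasCompactSupport_partial hc _
    let Au : Fin n → LqSpace n N (ENNReal.ofReal p) := fun j =>
      (D.coeff j).compLpL (ENNReal.ofReal p) volume u
    let Ay : Fin n → LqSpace n N (ENNReal.ofReal q) := fun j =>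
      (ContinuousLinearMap.adjoint (D.coeff j)).compLpL (ENNReal.ofReal q) volume y
    have hleft : ∫ w, mollKernel ρ y f w ∂(volume.prod volume) =
        ∑ j, Complex.I * ∫ w, mollKernel (dρ j) y (Au j) w ∂(volume.prod volume) := by
      rw [integral_mollKernel_eq_left hpq hρ.continuous hc]
      simp only [fun j => integral_mollKernel_eq_left hpq (hdc j) (hds j) y (Au j)]
      have hint : ∀ j, Integrable fun x => inner ℂ (y x) (∫ t, dρ j (t - x) • Au j t) := by
        intro j
        have h1 := (integrable_mollKernel hpq (hdc j) (hds j) y (Au j)).integral_prod_left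
        refine h1.congr (Eventually.of_forall fun x => ?_)
        have hi : Integrable fun t => dρ j (t - x) • Au j t :=
          integrable_smul_Lp _ ((hdc j).comp (continuous_id.sub continuous_const))
            ((hds j).comp_homeomorph (Homeomorph.subRight x)) (Au j)
        simp only
        rw [← integral_inner hi]
        refine integral_congr_ae (Eventually.of_forall fun t => ?_)
        simp only [mollKernel]
        rw [← Complex.coe_smul, inner_smul_right]
      simp only [← integral_const_mul]
      rw [← integral_finsetSum _ fun j _ => (hint j).const_mul _]
      refine integral_congr_ae (Eventually.of_forall fun x => ?_)
      have hw := huf (fun t => ρ (t - x)) (hρ.comp (contDiff_id.sub contDiff_const))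
        (hc.comp_homeomorph (Homeomorph.subRight x))
      simp only
      rw [hw, inner_smul_right, inner_sum, Finset.mul_sum]
      refine Finset.sum_congr rfl fun j _ => ?_
      congr 2
      refine integral_congr_ae ?_
      filter_upwards [ContinuousLinearMap.coeFn_compLpL (D.coeff j) u] with t ht
      simp only [Au, ht, dρ]
      rw [fderiv_comp_sub]
    have hright : ∫ w, mollKernel ρ z u w ∂(volume.prod volume) =
        ∑ j, Complex.I * ∫ w, mollKernel (dρ j) (Ay j) u w ∂(volume.prod volume) := by
      rw [integral_mollKernel_eq_right hpq hρ.continuous hc]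
      simp only [fun j => integral_mollKernel_eq_right hpq (hdc j) (hds j) (Ay j) u]
      have hint : ∀ j, Integrable fun t => inner ℂ (∫ x, dρ j (t - x) • Ay j x) (u t) := by
        intro j
        have h1 := (integrable_mollKernel hpq (hdc j) (hds j) (Ay j) u).integral_prod_right
        refine h1.congr (Eventually.of_forall fun t => ?_)
        have hi : Integrable fun x => dρ j (t - x) • Ay j x :=
          integrable_smul_Lp _ ((hdc j).comp (continuous_const.sub continuous_id))
            ((hds j).comp_homeomorph (Homeomorph.subLeft t)) (Ay j)
        simp only
        rw [← integral_inner_const hi]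
        refine integral_congr_ae (Eventually.of_forall fun x => ?_)
        simp only [mollKernel]
        rw [← Complex.coe_smul, inner_smul_left, Complex.conj_ofReal]
      simp only [← integral_const_mul]
      rw [← integral_finsetSum _ fun j _ => (hint j).const_mul _]
      refine integral_congr_ae (Eventually.of_forall fun t => ?_)
      have hw := hyz (fun x => ρ (t - x)) (hρ.comp (contDiff_const.sub contDiff_id))
        (hc.comp_homeomorph (Homeomorph.subLeft t))
      simp only
      rw [hw, inner_smul_left, sum_inner, Finset.mul_sum]
      refine Finset.sum_congr rfl fun j _ => ?_
      have e : ∫ x, (fderiv ℝ (fun x => ρ (t - x)) x (EuclideanSpace.single j 1)) •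
          D.adjoint.coeff j (y x) = -∫ x, dρ j (t - x) • Ay j x := by
        rw [← integral_neg]
        refine integral_congr_ae ?_
        filter_upwards [ContinuousLinearMap.coeFn_compLpL
          (ContinuousLinearMap.adjoint (D.coeff j)) y] with x hx
        simp only [Ay, hx, dρ]
        have hd : fderiv ℝ (fun x => ρ (t - x)) x = -fderiv ℝ ρ (t - x) := by
          have h2 : HasFDerivAt (fun x : Rn n => t - x) (-ContinuousLinearMap.id ℝ (Rn n)) x :=
            (hasFDerivAt_id x).const_sub t
          have h3 := ((hρ.differentiable (by simp)) (t - x)).hasFDerivAt.comp x h2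
          have h4 := h3.fderiv
          simp only [Function.comp_def] at h4
          rw [h4]
          ext v
          simp
        rw [hd, neg_apply, neg_smul]
        rfl
      rw [e, inner_neg_left, Complex.conj_I]
      ring
    rw [hleft, hright]
    refine Finset.sum_congr rfl fun j _ => ?_
    rw [mollKernel_adjoint_ae]
  let φ : ℕ → ContDiffBump (0 : Rn n) := fun i =>
    ⟨1 / (2 * ((i : ℝ) + 1)), 1 / ((i : ℝ) + 1), by positivity, by
      apply one_div_lt_one_div_of_lt <;> linarith [(Nat.cast_nonneg i : (0 : ℝ) ≤ i)]⟩
  have hφ : Tendsto (fun i => (φ i).rOut) atTop (𝓝 0) := tendsto_one_div_add_atTop_nhds_zero_nat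
  refine tendsto_nhds_unique (tendsto_integral_mollKernel hpq z u hφ) ?_
  refine (tendsto_integral_mollKernel hpq y f hφ).congr fun i => ?_
  exact (hmoll _ (φ i).contDiff_normed (φ i).hasCompactSupport_normed).symm

theorem FirstOrderOp.WeakEq.congr {D : FirstOrderOp n N} {u u' f f' : Rn n → CN N}
    (h : D.WeakEq u f) (hu : u =ᵐ[volume] u') (hf : f =ᵐ[volume] f') : D.WeakEq u' f' := by
  intro φ hφ hc
  have h1 : ∫ x, φ x • f' x = ∫ x, φ x • f x :=
    integral_congr_ae (hf.mono fun x hx => by simp only [hx])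
  have h2 : ∀ j, ∫ x, (fderiv ℝ φ x (EuclideanSpace.single j 1)) • D.coeff j (u' x) =
      ∫ x, (fderiv ℝ φ x (EuclideanSpace.single j 1)) • D.coeff j (u x) := fun j =>
    integral_congr_ae (hu.mono fun x hx => by simp only [hx])
  rw [h1, h φ hφ hc]
  simp only [h2]

/-- `D(φ e) = -i ∑ j, ∂_j φ A_j e` for a test function `φ` and a vector `e`. -/
theorem FirstOrderOp.weakEq_test {φ : Rn n → ℝ} (hφ : ContDiff ℝ ((⊤ : ℕ∞) : WithTop ℕ∞) φ)
    (hc : HasCompactSupport φ) (e : CN N) :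
    D.WeakEq (fun x => φ x • e) (fun x => -Complex.I •
      ∑ j, (fderiv ℝ φ x (EuclideanSpace.single j 1)) • D.coeff j e) := by
  intro ψ hψ hcψ
  have hi1 : ∀ j, Integrable fun x => ψ x * fderiv ℝ φ x (EuclideanSpace.single j 1) := fun j =>
    (hψ.continuous.mul (continuous_partial hφ _)).integrable_of_hasCompactSupport hcψ.mul_right
  have hi2 : ∀ j, Integrable fun x => fderiv ℝ ψ x (EuclideanSpace.single j 1) * φ x := fun j =>
    ((continuous_partial hψ _).mul hφ.continuous).integrable_of_hasCompactSupport hc.mul_left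
  have hi3 : Integrable fun x => ψ x * φ x :=
    (hψ.continuous.mul hφ.continuous).integrable_of_hasCompactSupport hcψ.mul_right
  have hibp : ∀ j, ∫ x, ψ x * fderiv ℝ φ x (EuclideanSpace.single j 1) =
      -∫ x, fderiv ℝ ψ x (EuclideanSpace.single j 1) * φ x := fun j =>
    integral_mul_fderiv_eq_neg_fderiv_mul_of_integrable (hi2 j) (hi1 j) hi3
      (fun x _ => (hψ.differentiable (by simp)) x) (fun x _ => (hφ.differentiable (by simp)) x)
  have h1 : ∀ x, ψ x • (-Complex.I •
      ∑ j, (fderiv ℝ φ x (EuclideanSpace.single j 1)) • D.coeff j e) =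
      ∑ j, (ψ x * fderiv ℝ φ x (EuclideanSpace.single j 1)) • (-Complex.I • D.coeff j e) := by
    intro x
    rw [Finset.smul_sum, Finset.smul_sum]
    refine Finset.sum_congr rfl fun j _ => ?_
    rw [smul_comm (-Complex.I), smul_smul]
  simp only [h1]
  rw [integral_finsetSum _ fun j _ => (hi1 j).smul_const _, Finset.smul_sum]
  refine Finset.sum_congr rfl fun j _ => ?_
  have h2 : ∀ x, fderiv ℝ ψ x (EuclideanSpace.single j 1) • D.coeff j (φ x • e) =
      (fderiv ℝ ψ x (EuclideanSpace.single j 1) * φ x) • D.coeff j e := by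
    intro x
    rw [ContinuousLinearMap.map_smul_of_tower, smul_smul]
  simp only [h2]
  rw [integral_smul_const, integral_smul_const, hibp, neg_smul, neg_smul, smul_neg, neg_neg,
    smul_comm]

theorem FirstOrderOp.integral_inner_test {φ : Rn n → ℝ}
    (hφ : ContDiff ℝ ((⊤ : ℕ∞) : WithTop ℕ∞) φ) (hc : HasCompactSupport φ) (e : CN N)
    (y : LqSpace n N (ENNReal.ofReal q)) :
    ∫ x, inner ℂ (y x) (-Complex.I •
        ∑ j, (fderiv ℝ φ x (EuclideanSpace.single j 1)) • D.coeff j e) =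
      inner ℂ (Complex.I • ∑ j, ∫ x, (fderiv ℝ φ x (EuclideanSpace.single j 1)) •
        D.adjoint.coeff j (y x)) e := by
  have hint : ∀ j, Integrable fun x => (fderiv ℝ φ x (EuclideanSpace.single j 1)) •
      D.adjoint.coeff j (y x) := fun j =>
    integrable_smul_clm_Lp _ (continuous_partial hφ _) (hasCompactSupport_partial hc _) _ y
  have hsum := integrable_finsetSum Finset.univ fun j _ => hint j
  rw [← integral_finsetSum _ fun j _ => hint j, inner_smul_left,
    ← integral_inner_const hsum, ← integral_const_mul]
  refine integral_congr_ae (Eventually.of_forall fun x => ?_)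
  simp only [inner_smul_right, inner_sum, sum_inner, Complex.conj_I]
  congr 1
  refine Finset.sum_congr rfl fun j _ => ?_
  rw [← Complex.coe_smul, ← Complex.coe_smul, inner_smul_left, inner_smul_right,
    Complex.conj_ofReal]
  congr 1
  exact (ContinuousLinearMap.adjoint_inner_left (D.coeff j) e (y x)).symm

theorem FirstOrderOp.exists_test (r : ℝ≥0∞) {φ : Rn n → ℝ}
    (hφ : ContDiff ℝ ((⊤ : ℕ∞) : WithTop ℕ∞) φ) (hc : HasCompactSupport φ) (e : CN N) :
    ∃ U F : LqSpace n N r, D.WeakEq U F ∧ U =ᵐ[volume] (fun x => φ x • e) ∧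
      F =ᵐ[volume] fun x => -Complex.I •
        ∑ j, (fderiv ℝ φ x (EuclideanSpace.single j 1)) • D.coeff j e := by
  have hu : MemLp (fun x => φ x • e) r volume :=
    (hφ.continuous.smul continuous_const).memLp_of_hasCompactSupport hc.smul_right
  have hj : ∀ j, MemLp (fun x => (fderiv ℝ φ x (EuclideanSpace.single j 1)) • D.coeff j e)
      r volume := by
    intro j
    have h1 : Continuous fun x => (fderiv ℝ φ x (EuclideanSpace.single j 1)) • D.coeff j e :=
      (continuous_partial hφ _).smul continuous_const
    have h2 : HasCompactSupport fun x =>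
        (fderiv ℝ φ x (EuclideanSpace.single j 1)) • D.coeff j e :=
      (hasCompactSupport_partial hc (EuclideanSpace.single j 1)).smul_right
    exact h1.memLp_of_hasCompactSupport h2
  have hf : MemLp (fun x => -Complex.I •
      ∑ j, (fderiv ℝ φ x (EuclideanSpace.single j 1)) • D.coeff j e) r volume :=
    (memLp_finsetSum Finset.univ fun j _ => hj j).const_smul (-Complex.I)
  exact ⟨hu.toLp _, hf.toLp _, (D.weakEq_test hφ hc e).congr hu.coeFn_toLp.symm
    hf.coeFn_toLp.symm, hu.coeFn_toLp, hf.coeFn_toLp⟩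

theorem FirstOrderOp.weakEq_adjoint_of_pairing {r : ℝ≥0∞} {y z : LqSpace n N (ENNReal.ofReal q)}
    (h : ∀ U F : LqSpace n N r, D.WeakEq U F →
      ∫ x, inner ℂ (z x) (U x) = ∫ x, inner ℂ (y x) (F x)) : D.adjoint.WeakEq y z := by
  intro φ hφ hc
  refine ext_inner_right ℂ fun e => ?_
  obtain ⟨U, F, hUF, hU, hF⟩ := D.exists_test r hφ hc e
  rw [← D.integral_inner_test hφ hc e y,
    ← integral_inner_const (integrable_smul_Lp _ hφ.continuous hc z)]
  refine Eq.trans ?_ ((h U F hUF).trans ?_)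
  · refine integral_congr_ae (hU.mono fun x hx => ?_)
    simp only [hx]
    rw [← Complex.coe_smul, ← Complex.coe_smul, inner_smul_left,
      inner_smul_right, Complex.conj_ofReal]
  · exact integral_congr_ae (hF.mono fun x hx => by simp only [hx])

/-- `D^*` in `L^q` is the adjoint of `D` in `L^p`. -/
theorem FirstOrderOp.mem_graph_adjoint_iff (hpq : p.HolderConjugate q)
    (y z : LqSpace n N (ENNReal.ofReal q)) :
    (y, z) ∈ (D.adjoint.opLq (ENNReal.ofReal q)).graph ↔
      ∀ u : (D.opLq (ENNReal.ofReal p)).domain,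
        lpDualEquiv hpq z (u : LqSpace n N (ENNReal.ofReal p)) =
          lpDualEquiv hpq y (D.opLq (ENNReal.ofReal p) u) := by
  rw [FirstOrderOp.graph_opLq, FirstOrderOp.mem_graphLq]
  constructor
  · intro h u
    have hu := (D.opLq (ENNReal.ofReal p)).mem_graph u
    rw [FirstOrderOp.graph_opLq, FirstOrderOp.mem_graphLq] at hu
    rw [lpDualEquiv_apply, lpDualEquiv_apply]
    exact FirstOrderOp.WeakEq.integral_inner_eq D hpq h hu
  · intro h
    refine D.weakEq_adjoint_of_pairing (r := ENNReal.ofReal p) fun U F hUF => ?_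
    have hgr : (U, F) ∈ (D.opLq (ENNReal.ofReal p)).graph := by
      rw [FirstOrderOp.graph_opLq, FirstOrderOp.mem_graphLq]
      exact hUF
    obtain ⟨w, hw1, hw2⟩ := (D.opLq (ENNReal.ofReal p)).mem_graph_iff.1 hgr
    have key := h w
    simp only at hw1 hw2
    rwa [hw1, hw2] at key

end Adjoint

/-! ### Transfer of (R-)bisectoriality -/

section Bisector

theorem abs_arg_conj (z : ℂ) : |Complex.arg (conj z)| = |Complex.arg z| := by
  rw [Complex.arg_conj]
  split_ifs with h
  · rw [h]
  · rw [abs_neg]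

theorem conj_mem_openBisector {ω : ℝ} {z : ℂ} :
    conj z ∈ openBisector ω ↔ z ∈ openBisector ω := by
  unfold openBisector
  simp only [Set.mem_ofPred_eq, ← map_neg, abs_arg_conj, ne_eq, map_eq_zero]

theorem conj_mem_closedBisector {ω : ℝ} {z : ℂ} :
    conj z ∈ closedBisector ω ↔ z ∈ closedBisector ω := by
  unfold closedBisector
  simp only [Set.mem_ofPred_eq, ← map_neg, abs_arg_conj, map_eq_zero]

theorem mul_I_notMem_openBisector {r : ℝ} (hr : 0 < r) :
    (r : ℂ) * Complex.I ∉ openBisector (Real.pi / 2) := by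
  rintro ⟨-, h⟩
  rw [← mul_neg, Complex.arg_real_mul _ hr, Complex.arg_real_mul _ hr, Complex.arg_I,
    Complex.arg_neg_I, abs_neg, abs_of_pos (by positivity)] at h
  simp at h

end Bisector

section DualBound

/-- Square function estimates for families of one operator are uniform norm bounds. -/
theorem IsRBisectorialOfAngle.isBisectorialOfAngle {Ω : Type*} [MeasurableSpace Ω]
    {μ : Measure Ω} {N : ℕ} {q : ℝ≥0∞} [Fact (1 ≤ q)] {A : Lp (CN N) q μ →ₗ.[ℂ] Lp (CN N) q μ}
    {ω : ℝ} (h : IsRBisectorialOfAngle A ω) : IsBisectorialOfAngle A ω := by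
  refine ⟨h.1, h.2.1, fun ω' hω' => ?_⟩
  obtain ⟨C, hC, H⟩ := h.2.2 ω' hω'
  refine ⟨C, fun l hl0 hl => ?_⟩
  obtain ⟨R, hR, hb⟩ := H 1 (fun _ => l) (fun _ => ⟨hl0, hl⟩)
  refine ⟨R 0, hR 0, ContinuousLinearMap.opNorm_le_bound _ hC.le fun u => ?_⟩
  have h1 := hb (fun _ => u)
  have e : (fun j : Fin 1 => R j u) = fun _ => R 0 u := by
    ext1 j
    rw [Subsingleton.elim j 0]
  rw [e, squareFunctionNorm_single, squareFunctionNorm_single] at h1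
  have h2 := ENNReal.toReal_mono (by finiteness) h1
  rwa [ENNReal.toReal_mul, ENNReal.toReal_ofReal hC.le, toReal_enorm, toReal_enorm] at h2

variable {n N : ℕ} {p q : ℝ} [hP : Fact (1 ≤ ENNReal.ofReal p)] [hQ : Fact (1 ≤ ENNReal.ofReal q)]
  (D : FirstOrderOp n N) (B : LinftyMat n N)

theorem lpDualEquiv_mulLq_star (hpq : p.HolderConjugate q) (y : LqSpace n N (ENNReal.ofReal q))
    (x : LqSpace n N (ENNReal.ofReal p)) :
    lpDualEquiv hpq (mulLq _ (star B) y) x = lpDualEquiv hpq y (mulLq _ B x) := by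
  rw [lpDualEquiv_apply, lpDualEquiv_apply]
  refine integral_congr_ae ?_
  filter_upwards [coeFn_mulLq _ (star B) y, coeFn_mulLq _ B x, coeFn_star_LinftyMat B]
    with t h1 h2 h3
  rw [h1, h2, h3, ContinuousLinearMap.adjoint_inner_left]

/-- If `B D` is bisectorial in `L^p` and `B` is bounded below on the range of `D`, there is a bounded
operator `S` on `L^q` for which `I - B^* S` maps into the null space of `D^*` and `S` inverts `B^*`
on the range of `D^*`. -/
theorem exists_coprojection_of_isBisectorialOfAngle (hpq : p.HolderConjugate q) {ω : ℝ}
    (hω : ω < Real.pi / 2) (hlow : LowerBoundOnRange D (ENNReal.ofReal p) B)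
    (h : IsBisectorialOfAngle (opBD D (ENNReal.ofReal p) B) ω) :
    ∃ S : LqSpace n N (ENNReal.ofReal q) →L[ℂ] LqSpace n N (ENNReal.ofReal q),
      (∀ x, (x - mulLq _ (star B) (S x), (0 : LqSpace n N (ENNReal.ofReal q))) ∈
        (D.adjoint.opLq (ENNReal.ofReal q)).graph) ∧
      ∀ z ∈ LinearMap.range (D.adjoint.opLq (ENNReal.ofReal q)).toFun,
        S (mulLq _ (star B) z) = z := by
  obtain ⟨C, hC⟩ := h.2.2 _ hω
  obtain ⟨c, hc, hlow⟩ := hlow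
  -- the resolvents along the imaginary axis
  let l : ℕ → ℂ := fun i => (((i : ℝ) + 1 : ℝ) : ℂ) * Complex.I
  have hl0 : ∀ i, l i ≠ 0 := fun i => by
    have : (((i : ℝ) + 1 : ℝ) : ℂ) ≠ 0 := by
      rw [Complex.ofReal_ne_zero]; positivity
    exact mul_ne_zero this Complex.I_ne_zero
  have hl : ∀ i, l i ∉ openBisector (Real.pi / 2) := fun i =>
    mul_I_notMem_openBisector (by positivity)
  have hlim : Tendsto (fun i => (l i)⁻¹) atTop (𝓝 0) := by
    rw [tendsto_zero_iff_norm_tendsto_zero]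
    refine tendsto_one_div_add_atTop_nhds_zero_nat.congr fun i => ?_
    rw [norm_inv, norm_mul, Complex.norm_I, mul_one, Complex.norm_real, one_div,
      Real.norm_of_nonneg (by positivity)]
  choose R hR hRC using fun i => hC (l i) (hl0 i) (hl i)
  exact exists_dual_coprojection (lpDualEquiv_mulLq_star B hpq) (D.mem_graph_adjoint_iff hpq)
    hc hlow hl0 hlim hR hRC

theorem lowerBoundOnRange_of_coprojection {r : ℝ≥0∞} [Fact (1 ≤ r)] (E : FirstOrderOp n N)
    (A : LinftyMat n N) {S : LqSpace n N r →L[ℂ] LqSpace n N r}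
    (hS : ∀ z ∈ LinearMap.range (E.opLq r).toFun, S (mulLq _ A z) = z) :
    LowerBoundOnRange E r A := by
  refine ⟨(‖S‖ + 1)⁻¹, by positivity, fun z hz => ?_⟩
  rw [inv_mul_le_iff₀ (by positivity)]
  calc ‖z‖ = ‖S (mulLq _ A z)‖ := by rw [hS z hz]
    _ ≤ ‖S‖ * ‖mulLq _ A z‖ := S.le_opNorm _
    _ ≤ (‖S‖ + 1) * ‖mulLq _ A z‖ := by gcongr; simp

variable {D B}

/-- The qualitative parts of bisectoriality, closedness and the location of the spectrum, pass to the
dual side. -/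
theorem isClosed_and_spectrum_dual (hpq : p.HolderConjugate q) {ω : ℝ} (hω : ω < Real.pi / 2)
    (h : IsBisectorialOfAngle (opBD D (ENNReal.ofReal p) B) ω)
    {S : LqSpace n N (ENNReal.ofReal q) →L[ℂ] LqSpace n N (ENNReal.ofReal q)}
    (hS : ∀ x, (x - mulLq _ (star B) (S x), (0 : LqSpace n N (ENNReal.ofReal q))) ∈
        (D.adjoint.opLq (ENNReal.ofReal q)).graph) :
    (opBD D.adjoint (ENNReal.ofReal q) (star B)).IsClosed ∧
      unboundedSpectrum (opBD D.adjoint (ENNReal.ofReal q) (star B)) ⊆ closedBisector ω := by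
  constructor
  · obtain ⟨C, hC⟩ := h.2.2 _ hω
    obtain ⟨R, hR, -⟩ := hC ((1 : ℝ) * Complex.I) (by simp)
      (mul_I_notMem_openBisector one_pos)
    exact (isBoundedInverse_dual (lpDualEquiv_mulLq_star B hpq) (D.mem_graph_adjoint_iff hpq) hS
      (by simp) hR).isClosed (by simp)
  · intro z hz
    by_contra hzω
    have hz0 : z ≠ 0 := fun h0 => hzω (Or.inl h0)
    have hz0' : conj z ≠ 0 := by simpa using hz0
    have hcz : conj z ∉ closedBisector ω := fun h => hzω (conj_mem_closedBisector.1 h)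
    have hR : ∃ R, IsBoundedInverse (opBD D (ENNReal.ofReal p) B) (conj z) (-1) R := by
      by_contra hno
      exact hcz (h.2.1 hno)
    obtain ⟨R, hR⟩ := hR
    -- normalise `z I - A` to `I - z⁻¹ A` and back
    have h1 := hR.smul (inv_ne_zero hz0')
    rw [inv_mul_cancel₀ hz0'] at h1
    have h2 := (isBoundedInverse_dual (lpDualEquiv_mulLq_star B hpq)
      (D.mem_graph_adjoint_iff hpq) hS (by simpa using hz0) h1).smul hz0
    have e : z * conj ((conj z)⁻¹ * -1) = -1 := by
      simp [hz0]
    rw [mul_one, e] at h2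
    exact hz ⟨_, h2⟩

theorem IsBisectorialOfAngle.dual (hpq : p.HolderConjugate q) {ω : ℝ} (hω : ω < Real.pi / 2)
    (h : IsBisectorialOfAngle (opBD D (ENNReal.ofReal p) B) ω)
    {S : LqSpace n N (ENNReal.ofReal q) →L[ℂ] LqSpace n N (ENNReal.ofReal q)}
    (hS : ∀ x, (x - mulLq _ (star B) (S x), (0 : LqSpace n N (ENNReal.ofReal q))) ∈
        (D.adjoint.opLq (ENNReal.ofReal q)).graph) :
    IsBisectorialOfAngle (opBD D.adjoint (ENNReal.ofReal q) (star B)) ω := by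
  obtain ⟨h1, h2⟩ := isClosed_and_spectrum_dual hpq hω h hS
  refine ⟨h1, h2, fun ω' hω' => ?_⟩
  obtain ⟨C, hC⟩ := h.2.2 ω' hω'
  set Bs := mulLq (ENNReal.ofReal q) (star B)
  obtain ⟨K, hK0, hK⟩ := exists_norm_dualAdjoint_le (lpDualEquiv (μ := (volume : Measure (Rn n)))
    (N := N) hpq)
  refine ⟨1 + ‖Bs.comp S‖ + ‖Bs‖ * (K * C * ‖S‖), fun l hl0 hl => ?_⟩
  obtain ⟨R, hR, hRC⟩ := hC (conj l) (by simpa using hl0)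
    (fun h => hl (conj_mem_openBisector.1 h))
  have h3 := isBoundedInverse_dual (lpDualEquiv_mulLq_star B hpq)
    (D.mem_graph_adjoint_iff hpq) hS (by simpa using hl0) hR
  rw [Complex.conj_conj] at h3
  refine ⟨_, h3, ?_⟩
  have hRd : ‖dualAdjoint (lpDualEquiv hpq) R‖ ≤ K * C :=
    (hK R).trans (by gcongr)
  refine (norm_add_le _ _).trans (add_le_add ((norm_sub_le _ _).trans
    (add_le_add ContinuousLinearMap.norm_id_le le_rfl)) ?_)
  refine (ContinuousLinearMap.opNorm_comp_le _ _).trans ?_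
  gcongr
  refine (ContinuousLinearMap.opNorm_comp_le _ _).trans ?_
  gcongr

theorem IsRBisectorialOfAngle.dual (hpq : p.HolderConjugate q) {ω : ℝ} (hω : ω < Real.pi / 2)
    (h : IsRBisectorialOfAngle (opBD D (ENNReal.ofReal p) B) ω)
    {S : LqSpace n N (ENNReal.ofReal q) →L[ℂ] LqSpace n N (ENNReal.ofReal q)}
    (hS : ∀ x, (x - mulLq _ (star B) (S x), (0 : LqSpace n N (ENNReal.ofReal q))) ∈
        (D.adjoint.opLq (ENNReal.ofReal q)).graph) :
    IsRBisectorialOfAngle (opBD D.adjoint (ENNReal.ofReal q) (star B)) ω := by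
  obtain ⟨h1, h2⟩ := isClosed_and_spectrum_dual hpq hω h.isBisectorialOfAngle hS
  refine ⟨h1, h2, fun ω' hω' => ?_⟩
  obtain ⟨C, hC0, hC⟩ := h.2.2 ω' hω'
  set Bs := mulLq (ENNReal.ofReal q) (star B)
  obtain ⟨C1, hC1, H1⟩ := exists_squareFunctionNorm_apply_le (Bs.comp S)
  obtain ⟨C2, hC2, H2⟩ := exists_squareFunctionNorm_apply_le Bs
  obtain ⟨C3, hC3, H3⟩ := exists_squareFunctionNorm_apply_le S
  refine ⟨1 + C1 + C2 * (C * C3), by positivity, fun k l hl => ?_⟩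
  obtain ⟨R, hR, hRC⟩ := hC k (fun j => conj (l j)) (fun j => ⟨by simpa using (hl j).1,
    fun h => (hl j).2 (conj_mem_openBisector.1 h)⟩)
  refine ⟨fun j => ContinuousLinearMap.id ℂ _ - Bs.comp S +
    Bs.comp ((dualAdjoint (lpDualEquiv hpq) (R j)).comp S), fun j => ?_, fun v => ?_⟩
  · have h3 := isBoundedInverse_dual (lpDualEquiv_mulLq_star B hpq)
      (D.mem_graph_adjoint_iff hpq) hS (by simpa using (hl j).1) (hR j)
    rw [Complex.conj_conj] at h3
    exact h3
  · have e : (fun j => (ContinuousLinearMap.id ℂ (LqSpace n N (ENNReal.ofReal q)) - Bs.comp S +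
        Bs.comp ((dualAdjoint (lpDualEquiv hpq) (R j)).comp S)) (v j)) =
        fun j => (v j + -(Bs.comp S) (v j)) +
          Bs (dualAdjoint (lpDualEquiv hpq) (R j) (S (v j))) := by
      ext1 j
      simp [sub_eq_add_neg]
    rw [e]
    calc _ ≤ squareFunctionNorm (fun j => v j + -(Bs.comp S) (v j)) +
          squareFunctionNorm
            (fun j => Bs (dualAdjoint (lpDualEquiv hpq) (R j) (S (v j)))) :=
          squareFunctionNorm_add_le _ _
      _ ≤ (squareFunctionNorm v + ENNReal.ofReal C1 * squareFunctionNorm v) +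
          ENNReal.ofReal C2 * (ENNReal.ofReal C * (ENNReal.ofReal C3 * squareFunctionNorm v)) := by
        refine add_le_add ((squareFunctionNorm_add_le _ _).trans ?_) ?_
        · rw [squareFunctionNorm_neg]
          exact add_le_add le_rfl (H1 k v)
        · refine (H2 k _).trans (mul_le_mul_right ?_ _)
          refine (squareFunctionNorm_dualAdjoint_le hpq hRC fun j => S (v j)).trans ?_
          exact mul_le_mul_right (H3 k v) _
      _ = _ := by
        rw [ENNReal.ofReal_add (by positivity) (by positivity),
          ENNReal.ofReal_add zero_le_one hC1, ENNReal.ofReal_mul hC2, ENNReal.ofReal_mul hC0.le,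
          ENNReal.ofReal_one]
        ring

end DualBound

section Sets

variable {n N : ℕ} {p q : ℝ} {D : FirstOrderOp n N} {B : LinftyMat n N}

theorem mem_setB_dual (hpq : p.HolderConjugate q) (h : p ∈ setB B D) :
    q ∈ setB (star B) D.adjoint := by
  obtain ⟨⟨hp, hlow⟩, hp', ω, hω0, hω, hb⟩ := h
  have := fact_one_le_ofReal hp
  have := fact_one_le_ofReal hpq.symm.lt
  obtain ⟨S, hS, hS'⟩ := exists_coprojection_of_isBisectorialOfAngle D B hpq hω hlow hb
  exact ⟨⟨hpq.symm.lt, lowerBoundOnRange_of_coprojection _ _ hS'⟩, hpq.symm.lt, ω, hω0, hω,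
    hb.dual hpq hω hS⟩

theorem mem_setR_dual (hpq : p.HolderConjugate q) (h : p ∈ setR B D) :
    q ∈ setR (star B) D.adjoint := by
  obtain ⟨⟨hp, hlow⟩, hp', ω, hω0, hω, hb⟩ := h
  have := fact_one_le_ofReal hp
  have := fact_one_le_ofReal hpq.symm.lt
  obtain ⟨S, hS, hS'⟩ := exists_coprojection_of_isBisectorialOfAngle D B hpq hω hlow
    hb.isBisectorialOfAngle
  exact ⟨⟨hpq.symm.lt, lowerBoundOnRange_of_coprojection _ _ hS'⟩, hpq.symm.lt, ω, hω0, hω,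
    hb.dual hpq hω hS⟩

end Sets

end DiracLp

end

theorem proposition4p3 {n N : ℕ} (D : DiracLp.FirstOrderOp n N)
    (hD1 : D.SymbolCoercive) (hD2 : D.SymbolBisectorial)
    (B : DiracLp.LinftyMat n N) (p : ℝ) (hp : 1 < p) :
    (p ∈ DiracLp.setR B D ↔ p / (p - 1) ∈ DiracLp.setR (star B) D.adjoint) ∧
      (p ∈ DiracLp.setB B D ↔ p / (p - 1) ∈ DiracLp.setB (star B) D.adjoint) := by
  have hpq : p.HolderConjugate (p / (p - 1)) := Real.HolderConjugate.conjExponent hp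
  have hB : star (star B) = B := star_star B
  have hD : D.adjoint.adjoint = D := D.adjoint_adjoint
  refine ⟨⟨DiracLp.mem_setR_dual hpq, fun h => ?_⟩, ⟨DiracLp.mem_setB_dual hpq, fun h => ?_⟩⟩
  · have := DiracLp.mem_setR_dual hpq.symm h
    rwa [hB, hD] at this
  · have := DiracLp.mem_setB_dual hpq.symm h
    rwa [hB, hD] at this
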